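/- Let $m\ge 1$, and call $w\in\mathfrak S_{2m}$ fully supported if $\{w(1),\dots,w(r)\}\neq\{1,\dots,r\}$ for all $1\le r<2m$. For a fully supported $w\in\mathfrak S_n$, let $X(w)$ be Elnitsky's polygon: the equilateral $2n$-gon whose sides are labeled $1,\dots,n,w(n),\dots,w(1)$ in counterclockwise order starting from its top vertex, such that the first $n$ of these sides form half of a convex $2n$-gon and sides with the same label are parallel; the sides labeled $w(1),\dots,w(n)$, running from the top vertex to the bottom vertex, form its rightside boundary. A rhombic tiling of $X(w)$ is a tiling by rhombi whose edges are congruent and parallel to sides of $X(w)$. A right-perimeter tile is a tile that shares two consecutive edges with the rightside boundary, and it is forced if it appears as a right-perimeter tile in every rhombic tiling of $X(w)$. The maximal number of forced right-perimeter tiles of a fully supported permutation in $\mathfrak S_{2m}$ is $m$. A fully supported permutation $w\in\mathfrak S_{2m}$ has $m$ forced right-perimeter tiles if and only if $w(2k-1)>w(2k)$ for all $1\le k\le m$, and $$w(1)<w(3)<\cdots<w(2m-1)\qquad\text{and}\qquad w(2)<w(4)<\cdots<w(2m).$$ -/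

import Mathlib

noncomputable section

namespace Elnitsky

/-- Admissible edge directions. The edge labeled `i` (labels are `0, …, n - 1` here) is the unit
vector with argument `θ i`. All arguments lie in `(π, 2π)`, so that every edge points strictly
downwards, and they increase strictly, so that the edges `0, 1, …, n - 1`, placed head to tail,
run counterclockwise along one half of a convex equilateral `2n`-gon, from its top vertex to its
bottom vertex. -/
def IsAdmissible {n : ℕ} (θ : Fin n → ℝ) : Prop :=
  StrictMono θ ∧ ∀ i, θ i ∈ Set.Ioo Real.pi (2 * Real.pi)

/-- The unit edge vector with label `i`, in the Euclidean plane `ℂ`. -/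
def edgeVec {n : ℕ} (θ : Fin n → ℝ) (i : Fin n) : ℂ :=
  ⟨Real.cos (θ i), Real.sin (θ i)⟩

/-- The `k`-th vertex of the path that starts in the top vertex `0` and has consecutive edges
labeled `w 0, w 1, …, w (n - 1)`. -/
def pathVertex {n : ℕ} (θ : Fin n → ℝ) (w : Equiv.Perm (Fin n)) (k : ℕ) : ℂ :=
  ∑ i : Fin n with i.val < k, edgeVec θ (w i)

/-- The `k`-th edge (counted from `0`) of that path. -/
def pathEdge {n : ℕ} (θ : Fin n → ℝ) (w : Equiv.Perm (Fin n)) (k : ℕ) : Set ℂ :=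
  segment ℝ (pathVertex θ w k) (pathVertex θ w (k + 1))

/-- The path itself, as a set of points. For the permutation `w` this is the rightside boundary of
Elnitsky's polygon of `w`; for the identity it is the leftside boundary. -/
def path {n : ℕ} (θ : Fin n → ℝ) (w : Equiv.Perm (Fin n)) : Set ℂ :=
  {z | ∃ k < n, z ∈ pathEdge θ w k}

/-- Elnitsky's polygon `X(w)` as a closed region. Its sides are labeled
`1, …, n, w(n), …, w(1)` counterclockwise from the top vertex. Both boundary paths run strictly
downwards from the top vertex to the bottom vertex, so each of them meets each height in between
exactly once, and the region consists of the points that have the leftside boundary to their left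
and the rightside boundary to their right. -/
def polygon {n : ℕ} (θ : Fin n → ℝ) (w : Equiv.Perm (Fin n)) : Set ℂ :=
  {z | ∃ p ∈ path θ 1, ∃ q ∈ path θ w,
    p.im = z.im ∧ q.im = z.im ∧ p.re ≤ z.re ∧ z.re ≤ q.re}

/-- A rhombic tile: its top vertex and its two labels `a < b`. These determine the rhombus, and
are determined by it. -/
structure Tile (n : ℕ) where
  top : ℂ
  a : Fin n
  b : Fin n
  a_lt_b : a < b

/-- The closed rhombus of a tile. -/
def Tile.carrier {n : ℕ} (θ : Fin n → ℝ) (t : Tile n) : Set ℂ :=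
  {z | ∃ r ∈ Set.Icc (0 : ℝ) 1, ∃ s ∈ Set.Icc (0 : ℝ) 1,
    z = t.top + r • edgeVec θ t.a + s • edgeVec θ t.b}

/-- The four edges of a tile. -/
def Tile.edges {n : ℕ} (θ : Fin n → ℝ) (t : Tile n) : Set (Set ℂ) :=
  {segment ℝ t.top (t.top + edgeVec θ t.a),
   segment ℝ t.top (t.top + edgeVec θ t.b),
   segment ℝ (t.top + edgeVec θ t.a) (t.top + edgeVec θ t.a + edgeVec θ t.b),
   segment ℝ (t.top + edgeVec θ t.b) (t.top + edgeVec θ t.a + edgeVec θ t.b)}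

/-- `T` is a rhombic tiling of Elnitsky's polygon of `w`: the tiles have pairwise disjoint
interiors, and their union is the polygon. -/
def IsTiling {n : ℕ} (θ : Fin n → ℝ) (w : Equiv.Perm (Fin n)) (T : Finset (Tile n)) : Prop :=
  (T : Set (Tile n)).Pairwise
      (fun s t => Disjoint (interior (s.carrier θ)) (interior (t.carrier θ))) ∧
    (⋃ t ∈ T, t.carrier θ) = polygon θ w

/-- The tile `t` shares (at least) two consecutive edges with the rightside boundary. -/
def IsRightPerimeter {n : ℕ} (θ : Fin n → ℝ) (w : Equiv.Perm (Fin n)) (t : Tile n) : Prop :=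
  ∃ k : ℕ, k + 1 < n ∧ pathEdge θ w k ∈ t.edges θ ∧ pathEdge θ w (k + 1) ∈ t.edges θ

/-- The tile `t` appears as a right-perimeter tile in every rhombic tiling. -/
def IsForcedRightPerimeter {n : ℕ} (θ : Fin n → ℝ) (w : Equiv.Perm (Fin n)) (t : Tile n) : Prop :=
  ∀ T : Finset (Tile n), IsTiling θ w T → t ∈ T ∧ IsRightPerimeter θ w t

/-- The number of forced right-perimeter tiles. -/
def numForcedRight {n : ℕ} (θ : Fin n → ℝ) (w : Equiv.Perm (Fin n)) : ℕ∞ :=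
  {t : Tile n | IsForcedRightPerimeter θ w t}.encard

/-- `w` is fully supported: no proper nonempty initial segment is mapped onto itself. -/
def FullySupported {n : ℕ} (w : Equiv.Perm (Fin n)) : Prop :=
  ∀ r : ℕ, 0 < r → r < n → w '' {i | i.val < r} ≠ {i | i.val < r}

end Elnitsky

end

/-! Slice the plane by horizontal lines. Every edge points strictly down, so each boundary path is
the graph of a piecewise affine function of depth (`profile`), each tile is the region between two
such functions, and a tiling amounts to intervals filling every slice (`Dissects`). Gluing the tile
at a descent `k` onto a dissection for the permutation with the values at `k`, `k + 1` exchanged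
gives a dissection for `w`, and removing that tile undoes this. So dissections exist by sorting
(`exists_dissects`); conversely, a dissection of a permutation with a descent contains the tile at
some descent (`Dissects.exists_tileAt_mem`).

A right-perimeter tile of a dissection sits at a descent. If a forced tile sits at `k`, no
neighbouring position is a descent, since some tiling uses that other descent and the two tiles
would overlap. With positions counted from `0`, each pair `{2i, 2i + 1}` thus holds at most one
forced tile, which bounds their number by `m`. If `m` is attained, every pair holds one, and working
back from the last pair puts it at `2i`. If two consecutive upper values (at even positions) or
lower values (at odd positions) were in the wrong order, exchanging at one descent would create a
new descent whose tile uses an edge of the neighbouring forced tile, so some tiling would avoid the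
forced tile.

Conversely, the two increasing chains make every value before position `2i` smaller than the value
there, and every value after `2i + 1` larger than the value at `2i + 1`. Peeling other tiles off a
tiling preserves this and never touches these two positions, so the tile at `2i` must eventually be
found (`Dissects.tileAt_mem`). An interleaving of two increasing halves attains `m`. -/

noncomputable section

namespace Elnitsky

/-! ### Boundary paths as graphs over depth -/

section

variable {n : ℕ} {θ : Fin n → ℝ}

/-- The vertical extent of the edge labeled `i`. -/
def drop (θ : Fin n → ℝ) (i : Fin n) : ℝ := -Real.sin (θ i)

/-- The horizontal displacement per unit of depth along the edge labeled `i`. -/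
def slope (θ : Fin n → ℝ) (i : Fin n) : ℝ := Real.cos (θ i) / drop θ i

/-- The depth of the `k`-th vertex of the path below the top vertex. -/
def depth (θ : Fin n → ℝ) (w : Equiv.Perm (Fin n)) (k : ℕ) : ℝ := -(pathVertex θ w k).im

/-- The horizontal coordinate of the path at depth `d`. -/
def profile (θ : Fin n → ℝ) (w : Equiv.Perm (Fin n)) (d : ℝ) : ℝ :=
  ∑ i, slope θ (w i) * max 0 (min (d - depth θ w i) (drop θ (w i)))

theorem IsAdmissible.drop_pos (hθ : IsAdmissible θ) (i : Fin n) : 0 < drop θ i := by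
  have h := hθ.2 i
  have h1 : 0 < Real.sin (θ i - Real.pi) :=
    Real.sin_pos_of_pos_of_lt_pi (by linarith [h.1]) (by linarith [h.2])
  rw [Real.sin_sub_pi] at h1
  exact h1

theorem IsAdmissible.slope_mul_drop (hθ : IsAdmissible θ) (i : Fin n) :
    slope θ i * drop θ i = Real.cos (θ i) :=
  div_mul_cancel₀ _ (hθ.drop_pos i).ne'

theorem IsAdmissible.slope_strictMono (hθ : IsAdmissible θ) : StrictMono (slope θ) := by
  intro i j hij
  rw [slope, slope, div_lt_div_iff₀ (hθ.drop_pos i) (hθ.drop_pos j)]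
  have h1 := hθ.1 hij
  have h2 : 0 < Real.sin (θ j - θ i) := Real.sin_pos_of_pos_of_lt_pi (by linarith)
    (by linarith [(hθ.2 i).1, (hθ.2 j).2])
  rw [Real.sin_sub] at h2
  simp only [drop]
  nlinarith

@[simp] theorem edgeVec_re (i : Fin n) : (edgeVec θ i).re = Real.cos (θ i) := rfl

@[simp] theorem edgeVec_im (i : Fin n) : (edgeVec θ i).im = -drop θ i := by
  simp [edgeVec, drop]

theorem sum_val_lt_succ {M : Type*} [AddCommMonoid M] (f : Fin n → M) (k : ℕ) (hk : k < n) :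
    ∑ i : Fin n with i.val < k + 1, f i = (∑ i : Fin n with i.val < k, f i) + f ⟨k, hk⟩ := by
  have : (Finset.univ.filter fun i : Fin n => i.val < k + 1) =
      insert ⟨k, hk⟩ (Finset.univ.filter fun i : Fin n => i.val < k) := by
    ext i
    simp [Fin.ext_iff]
    omega
  rw [this, Finset.sum_insert (by simp), add_comm]

theorem pathVertex_zero (w : Equiv.Perm (Fin n)) : pathVertex θ w 0 = 0 := by
  simp [pathVertex]

theorem pathVertex_succ (w : Equiv.Perm (Fin n)) {k : ℕ} (hk : k < n) :
    pathVertex θ w (k + 1) = pathVertex θ w k + edgeVec θ (w ⟨k, hk⟩) :=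
  sum_val_lt_succ _ k hk

theorem pathVertex_mul (w σ : Equiv.Perm (Fin n)) (k : ℕ)
    (h : ∀ i : Fin n, i.val < k ↔ (σ i).val < k) :
    pathVertex θ (w * σ) k = pathVertex θ w k := by
  unfold pathVertex
  exact Finset.sum_equiv σ (by simpa using h) (by simp)

theorem depth_zero (w : Equiv.Perm (Fin n)) : depth θ w 0 = 0 := by
  simp [depth, pathVertex_zero]

theorem depth_succ (w : Equiv.Perm (Fin n)) {k : ℕ} (hk : k < n) :
    depth θ w (k + 1) = depth θ w k + drop θ (w ⟨k, hk⟩) := by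
  simp [depth, pathVertex_succ w hk]; ring

theorem depth_last (w : Equiv.Perm (Fin n)) : depth θ w n = depth θ 1 n := by
  have := pathVertex_mul (θ := θ) 1 w n (by simp)
  rw [one_mul] at this
  simp [depth, this]

theorem depth_lt (hθ : IsAdmissible θ) (w : Equiv.Perm (Fin n)) {j k : ℕ} (hjk : j < k)
    (hk : k ≤ n) : depth θ w j < depth θ w k := by
  induction k, hjk using Nat.le_induction with
  | base => rw [depth_succ w hk]; linarith [hθ.drop_pos (w ⟨j, hk⟩)]
  | succ k hjk ih =>
    rw [depth_succ w hk]; linarith [hθ.drop_pos (w ⟨k, hk⟩), ih (by omega)]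

theorem depth_le (hθ : IsAdmissible θ) (w : Equiv.Perm (Fin n)) {j k : ℕ} (hjk : j ≤ k)
    (hk : k ≤ n) : depth θ w j ≤ depth θ w k := by
  rcases hjk.eq_or_lt with rfl | h
  · rfl
  · exact (depth_lt hθ w h hk).le

theorem depth_nonneg (hθ : IsAdmissible θ) (w : Equiv.Perm (Fin n)) {k : ℕ} (hk : k ≤ n) :
    0 ≤ depth θ w k := by
  rw [← depth_zero (θ := θ) w]
  exact depth_le hθ w (Nat.zero_le k) hk

theorem depth_le_last (hθ : IsAdmissible θ) (w : Equiv.Perm (Fin n)) {k : ℕ} (hk : k ≤ n) :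
    depth θ w k ≤ depth θ 1 n := by
  rw [← depth_last w]
  exact depth_le hθ w hk le_rfl

theorem exists_window (w : Equiv.Perm (Fin n)) {d : ℝ} (h0 : 0 ≤ d) (h1 : d < depth θ 1 n) :
    ∃ k, k < n ∧ depth θ w k ≤ d ∧ d < depth θ w (k + 1) := by
  rw [← depth_last w] at h1
  have key : ∀ j, j ≤ n → d < depth θ w j →
      ∃ k, k < n ∧ depth θ w k ≤ d ∧ d < depth θ w (k + 1) := by
    intro j
    induction j with
    | zero => intro _ h; rw [depth_zero] at h; linarith
    | succ j ih =>
      intro hj h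
      by_cases hd : d < depth θ w j
      · exact ih (by omega) hd
      · exact ⟨j, hj, not_lt.1 hd, h⟩
  exact key n le_rfl h1

theorem exists_window_le (hθ : IsAdmissible θ) (hn : 0 < n) (w : Equiv.Perm (Fin n)) {d : ℝ}
    (h0 : 0 ≤ d) (h1 : d ≤ depth θ 1 n) :
    ∃ k, k < n ∧ depth θ w k ≤ d ∧ d ≤ depth θ w (k + 1) := by
  rcases h1.eq_or_lt with rfl | h
  · exact ⟨n - 1, by omega, depth_le_last hθ w (by omega),
      by rw [Nat.sub_add_cancel hn, depth_last w]⟩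
  · obtain ⟨k, hk, h2, h3⟩ := exists_window w h0 h
    exact ⟨k, hk, h2, h3.le⟩

theorem max_min_of_full {x h : ℝ} (hh : 0 ≤ h) (hx : h ≤ x) : max 0 (min x h) = h := by
  rw [min_eq_right hx, max_eq_right hh]

theorem max_min_of_empty {x h : ℝ} (hx : x ≤ 0) : max 0 (min x h) = 0 :=
  max_eq_left ((min_le_left _ _).trans hx)

theorem max_min_of_mem {x h : ℝ} (h0 : 0 ≤ x) (hx : x ≤ h) : max 0 (min x h) = x := by
  rw [min_eq_left hx, max_eq_right h0]

/-- At a depth inside edge `k`, the earlier edges count in full, edge `k` in part, the later ones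
not at all. The weight `f` is arbitrary because both slopes (`profile_eq`) and the constant `1`
(`sum_clamp`) are needed. -/
theorem sum_window (hθ : IsAdmissible θ) (w : Equiv.Perm (Fin n)) {k : ℕ} (hk : k < n) {d : ℝ}
    (h0 : depth θ w k ≤ d) (h1 : d ≤ depth θ w (k + 1)) (f : Fin n → ℝ) :
    ∑ i, f (w i) * max 0 (min (d - depth θ w i) (drop θ (w i))) =
      (∑ i : Fin n with i.val < k, f (w i) * drop θ (w i)) +
        f (w ⟨k, hk⟩) * (d - depth θ w k) := by
  have e : ∀ i : Fin n, f (w i) * max 0 (min (d - depth θ w i) (drop θ (w i))) =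
      if i.val < k + 1 then (if i.val < k then f (w i) * drop θ (w i) else
        f (w ⟨k, hk⟩) * (d - depth θ w k)) else 0 := by
    intro i
    have hi := hθ.drop_pos (w i)
    split_ifs with h2 h3
    · have := depth_le hθ w (j := i + 1) (k := k) h3 hk.le
      rw [depth_succ w i.2] at this
      rw [max_min_of_full hi.le (by simp only [Fin.eta] at this; linarith)]
    · obtain rfl : i = ⟨k, hk⟩ := Fin.ext (by simp; omega)
      rw [depth_succ w hk] at h1
      rw [max_min_of_mem (by simpa using h0) (by simp only; linarith)]
    · have := depth_le hθ w (j := k + 1) (k := i) (by omega) i.2.le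
      rw [max_min_of_empty (by linarith), mul_zero]
  rw [Finset.sum_congr rfl fun i _ => e i, ← Finset.sum_filter, sum_val_lt_succ _ k hk]
  congr 1
  · exact Finset.sum_congr rfl fun i hi => if_pos (by simpa using hi)
  · simp

theorem profile_eq (hθ : IsAdmissible θ) (w : Equiv.Perm (Fin n)) {k : ℕ} (hk : k < n) {d : ℝ}
    (h0 : depth θ w k ≤ d) (h1 : d ≤ depth θ w (k + 1)) :
    profile θ w d = (pathVertex θ w k).re + slope θ (w ⟨k, hk⟩) * (d - depth θ w k) := by
  rw [profile, sum_window hθ w hk h0 h1 (slope θ)]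
  simp [pathVertex, hθ.slope_mul_drop]

theorem sum_clamp (hθ : IsAdmissible θ) (w : Equiv.Perm (Fin n)) {d : ℝ}
    (h0 : 0 ≤ d) (h1 : d < depth θ 1 n) :
    ∑ i : Fin n, max 0 (min (d - depth θ w i) (drop θ (w i))) = d := by
  obtain ⟨k, hk, h2, h3⟩ := exists_window w h0 h1
  have := sum_window hθ w hk h2 h3.le 1
  simp only [Pi.one_apply, one_mul] at this
  rw [this]
  simp [depth, pathVertex]

theorem continuous_profile (w : Equiv.Perm (Fin n)) : Continuous (profile θ w) := by
  unfold profile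
  fun_prop

theorem mem_pathEdge (hθ : IsAdmissible θ) (w : Equiv.Perm (Fin n)) {k : ℕ} (hk : k < n) (z : ℂ) :
    z ∈ pathEdge θ w k ↔ depth θ w k ≤ -z.im ∧ -z.im ≤ depth θ w (k + 1) ∧
      z.re = profile θ w (-z.im) := by
  have hp := hθ.drop_pos (w ⟨k, hk⟩)
  have hs := hθ.slope_mul_drop (w ⟨k, hk⟩)
  rw [pathEdge, segment_eq_image', depth_succ w hk, pathVertex_succ w hk]
  simp only [add_sub_cancel_left, Set.mem_image, Set.mem_Icc]
  constructor
  · rintro ⟨r, ⟨hr0, hr1⟩, rfl⟩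
    have h0 : depth θ w k ≤ -(pathVertex θ w k + r • edgeVec θ (w ⟨k, hk⟩)).im := by
      simp [depth]; positivity
    have h1 : -(pathVertex θ w k + r • edgeVec θ (w ⟨k, hk⟩)).im ≤
        depth θ w k + drop θ (w ⟨k, hk⟩) := by
      simp [depth]; nlinarith
    refine ⟨h0, h1, ?_⟩
    rw [profile_eq hθ w hk h0 (by rwa [depth_succ w hk])]
    simp [depth, ← hs]; ring
  · rintro ⟨h0, h1, h2⟩
    rw [profile_eq hθ w hk h0 (by rwa [depth_succ w hk])] at h2
    refine ⟨(-z.im - depth θ w k) / drop θ (w ⟨k, hk⟩), ⟨by apply div_nonneg <;> linarith, ?_⟩, ?_⟩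
    · rw [div_le_one hp]; linarith
    · apply Complex.ext
      · simp [h2, ← hs]; field_simp
      · simp; field_simp; simp [depth]

theorem mem_path (hθ : IsAdmissible θ) (hn : 0 < n) (w : Equiv.Perm (Fin n)) (z : ℂ) :
    z ∈ path θ w ↔ 0 ≤ -z.im ∧ -z.im ≤ depth θ 1 n ∧ z.re = profile θ w (-z.im) := by
  constructor
  · rintro ⟨k, hk, h⟩
    rw [mem_pathEdge hθ w hk] at h
    exact ⟨(depth_nonneg hθ w hk.le).trans h.1, h.2.1.trans (depth_le_last hθ w hk), h.2.2⟩
  · rintro ⟨h0, h1, h2⟩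
    obtain ⟨k, hk, h3, h4⟩ := exists_window_le hθ hn w h0 h1
    exact ⟨k, hk, (mem_pathEdge hθ w hk z).2 ⟨h3, h4, h2⟩⟩

theorem mem_polygon (hθ : IsAdmissible θ) (hn : 0 < n) (w : Equiv.Perm (Fin n)) (z : ℂ) :
    z ∈ polygon θ w ↔ 0 ≤ -z.im ∧ -z.im ≤ depth θ 1 n ∧
      profile θ 1 (-z.im) ≤ z.re ∧ z.re ≤ profile θ w (-z.im) := by
  constructor
  · rintro ⟨p, hp, q, hq, h1, h2, h3, h4⟩
    rw [mem_path hθ hn] at hp hq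
    rw [← h1]
    refine ⟨hp.1, hp.2.1, hp.2.2 ▸ h3, ?_⟩
    rw [h1, ← h2, ← hq.2.2]
    exact h4
  · rintro ⟨h0, h1, h2, h3⟩
    exact ⟨⟨profile θ 1 (-z.im), z.im⟩, (mem_path hθ hn _ _).2 ⟨h0, h1, rfl⟩,
      ⟨profile θ w (-z.im), z.im⟩, (mem_path hθ hn _ _).2 ⟨h0, h1, rfl⟩, rfl, rfl, h2, h3⟩

/-! ### The leftside boundary lies to the left of the rightside boundary -/

/-- The vertical extent of the part of the edge labeled `i` that lies above depth `d`. -/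
def fill (θ : Fin n → ℝ) (w : Equiv.Perm (Fin n)) (d : ℝ) (i : Fin n) : ℝ :=
  max 0 (min (d - depth θ w (w.symm i)) (drop θ i))

theorem profile_eq_fill (w : Equiv.Perm (Fin n)) (d : ℝ) :
    profile θ w d = ∑ i, slope θ i * fill θ w d i := by
  rw [← Equiv.sum_comp w fun i => slope θ i * fill θ w d i]
  simp [fill, profile]

theorem sum_fill (hθ : IsAdmissible θ) (w : Equiv.Perm (Fin n)) {d : ℝ}
    (h0 : 0 ≤ d) (h1 : d < depth θ 1 n) : ∑ i, fill θ w d i = d := by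
  rw [← Equiv.sum_comp w]
  simpa [fill] using sum_clamp hθ w h0 h1

theorem fill_nonneg (w : Equiv.Perm (Fin n)) (d : ℝ) (i : Fin n) : 0 ≤ fill θ w d i :=
  le_max_left _ _

theorem fill_le (hθ : IsAdmissible θ) (w : Equiv.Perm (Fin n)) (d : ℝ) (i : Fin n) :
    fill θ w d i ≤ drop θ i :=
  max_le (hθ.drop_pos i).le (min_le_right _ _)

theorem fill_of_before (hθ : IsAdmissible θ) (w : Equiv.Perm (Fin n)) {d : ℝ} {k : ℕ} (hk : k < n)
    (h0 : depth θ w k ≤ d) {i : Fin n} (hi : (w.symm i).val < k) : fill θ w d i = drop θ i := by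
  apply max_min_of_full (hθ.drop_pos i).le
  have h1 := depth_succ (θ := θ) w (w.symm i).2
  have h2 := depth_le hθ w (j := (w.symm i).val + 1) hi hk.le
  simp only [Fin.eta, Equiv.apply_symm_apply] at h1
  linarith

theorem fill_of_after (hθ : IsAdmissible θ) (w : Equiv.Perm (Fin n)) {d : ℝ} {k : ℕ}
    (h1 : d ≤ depth θ w (k + 1)) {i : Fin n} (hi : k < (w.symm i).val) : fill θ w d i = 0 := by
  apply max_min_of_empty
  have := depth_le hθ w (j := k + 1) (k := (w.symm i).val) hi (w.symm i).2.le
  linarith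

/-- Both paths spend the same total depth `d`, so a common slope may be subtracted freely. Choosing
that of the leftside edge at depth `d` makes every term nonnegative: the leftside path exhausts all
smaller slopes and has not begun the larger ones. -/
theorem profile_sub (hθ : IsAdmissible θ) (w : Equiv.Perm (Fin n)) {d : ℝ}
    (h0 : 0 ≤ d) (h1 : d < depth θ 1 n) (j : Fin n) :
    profile θ w d - profile θ 1 d =
      ∑ i, (slope θ i - slope θ j) * (fill θ w d i - fill θ 1 d i) := by
  rw [profile_eq_fill, profile_eq_fill]
  have h2 := sum_fill hθ w h0 h1
  have h3 := sum_fill hθ 1 h0 h1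
  have : ∑ i, slope θ j * (fill θ w d i - fill θ 1 d i) = 0 := by
    rw [← Finset.mul_sum, Finset.sum_sub_distrib, h2, h3]; ring
  rw [← sub_eq_zero, ← Finset.sum_sub_distrib, ← Finset.sum_sub_distrib, ← this]
  exact Finset.sum_congr rfl fun i _ => by ring

theorem profile_sub_term_nonneg (hθ : IsAdmissible θ) (w : Equiv.Perm (Fin n)) {d : ℝ} {j : ℕ}
    (hj : j < n) (h0 : depth θ 1 j ≤ d) (h1 : d ≤ depth θ 1 (j + 1)) (i : Fin n) :
    0 ≤ (slope θ i - slope θ ⟨j, hj⟩) * (fill θ w d i - fill θ 1 d i) := by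
  rcases lt_trichotomy i.val j with h | h | h
  · rw [fill_of_before hθ 1 hj h0 (i := i) h]
    exact mul_nonneg_of_nonpos_of_nonpos
      (sub_nonpos.2 (hθ.slope_strictMono.monotone (Fin.mk_le_mk.2 h.le)))
      (sub_nonpos.2 (fill_le hθ w d i))
  · subst h; simp
  · rw [fill_of_after hθ 1 h1 (i := i) h, sub_zero]
    exact mul_nonneg (sub_nonneg.2 (hθ.slope_strictMono.monotone (Fin.mk_le_mk.2 h.le)))
      (fill_nonneg _ _ _)

theorem profile_one_le (hθ : IsAdmissible θ) (w : Equiv.Perm (Fin n)) {d : ℝ}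
    (h0 : 0 ≤ d) (h1 : d ≤ depth θ 1 n) : profile θ 1 d ≤ profile θ w d := by
  rcases h0.eq_or_lt with rfl | h0'
  · rcases h1.eq_or_lt with h | h
    · have : ∀ v : Equiv.Perm (Fin n), profile θ v 0 = 0 := by
        intro v
        refine Finset.sum_eq_zero fun i _ => ?_
        rw [max_min_of_empty (by linarith [depth_nonneg hθ v i.2.le]), mul_zero]
      rw [this, this]
    · obtain ⟨j, hj, h2, h3⟩ := exists_window 1 le_rfl h
      rw [← sub_nonneg, profile_sub hθ w le_rfl h ⟨j, hj⟩]
      exact Finset.sum_nonneg fun i _ => profile_sub_term_nonneg hθ w hj h2 h3.le i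
  -- `sum_fill` excludes the bottom depth, which is reached by continuity.
  · have hcl : d ∈ closure (Set.Ioo 0 (depth θ 1 n)) := by
      rw [closure_Ioo (by linarith)]; exact ⟨h0, h1⟩
    refine le_on_closure (f := profile θ 1) (g := profile θ w) (fun x hx => ?_)
      (continuous_profile _).continuousOn (continuous_profile _).continuousOn hcl
    obtain ⟨j, hj, h2, h3⟩ := exists_window 1 hx.1.le hx.2
    rw [← sub_nonneg, profile_sub hθ w hx.1.le hx.2 ⟨j, hj⟩]
    exact Finset.sum_nonneg fun i _ => profile_sub_term_nonneg hθ w hj h2 h3.le i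

/-- Equality kills every term of a nonnegative sum, so the two paths have used equally much of each
label except possibly `j`. The labels that `w` has finished are then squeezed between `{i < j}` and
`{i ≤ j}`, hence form an initial segment, which full support forbids. -/
theorem FullySupported.profile_one_lt {w : Equiv.Perm (Fin n)} (hw : FullySupported w)
    (hθ : IsAdmissible θ) (hn : 1 < n) {d : ℝ} (h0 : 0 < d) (h1 : d < depth θ 1 n) :
    profile θ 1 d < profile θ w d := by
  refine lt_of_le_of_ne (profile_one_le hθ w h0.le h1.le) fun he => ?_
  obtain ⟨j, hj, h2, h3⟩ := exists_window 1 h0.le h1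
  obtain ⟨k, hk, h4, h5⟩ := exists_window w h0.le h1
  have hs := profile_sub hθ w h0.le h1 ⟨j, hj⟩
  rw [he, sub_self, eq_comm, Finset.sum_eq_zero_iff_of_nonneg
    fun i _ => profile_sub_term_nonneg hθ w hj h2 h3.le i] at hs
  have hfill : ∀ i : Fin n, i.val ≠ j → fill θ w d i = fill θ 1 d i := by
    intro i hi
    rcases mul_eq_zero.1 (hs i (Finset.mem_univ i)) with h | h
    · exact absurd (congrArg Fin.val (hθ.slope_strictMono.injective (sub_eq_zero.1 h))) hi
    · exact sub_eq_zero.1 h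
  have hA : ∀ i : Fin n, i.val < j → (w.symm i).val < k := by
    intro i hi
    have h6 := hfill i hi.ne
    rw [fill_of_before hθ 1 hj h2 (i := i) hi] at h6
    by_contra hc
    rcases (not_lt.1 hc).eq_or_lt with h | h
    · have h7 := depth_succ (θ := θ) w hk
      have h8 : (⟨k, hk⟩ : Fin n) = w.symm i := Fin.ext h
      rw [h8, Equiv.apply_symm_apply] at h7
      rw [fill, ← h, max_min_of_mem (by linarith) (by linarith)] at h6
      linarith
    · rw [fill_of_after hθ w h5.le h] at h6
      linarith [hθ.drop_pos i]
  have hB : ∀ i : Fin n, (w.symm i).val < k → i.val ≤ j := by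
    intro i hi
    by_contra hc
    have h6 := hfill i (by omega)
    rw [fill_of_before hθ w hk h4 hi,
      fill_of_after hθ 1 h3.le (i := i) (show j < i.val by omega)] at h6
    linarith [hθ.drop_pos i]
  have himg : ∀ r, r ≤ n → (∀ i : Fin n, i.val < r ↔ (w.symm i).val < r) →
      w '' {i | i.val < r} = {i | i.val < r} := by
    intro r _ h
    ext i
    rw [Equiv.image_eq_preimage_symm]
    simpa using (h i).symm
  -- For `k = 0` the initial segment is empty and gives no contradiction; instead the partly used
  -- first edge must have label `0`, and `r = 1` contradicts full support.
  rcases Nat.eq_zero_or_pos k with rfl | hk0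
  · have hj0 : j = 0 := by
      by_contra hj0
      have := hA ⟨0, by omega⟩ (by simp; omega)
      omega
    subst hj0
    have hw0 : w ⟨0, hk⟩ = ⟨0, hk⟩ := by
      by_contra hc
      have h6 := hfill (w ⟨0, hk⟩) (fun h => hc (Fin.ext h))
      have h7 := depth_succ (θ := θ) w hk
      rw [fill_of_after hθ 1 h3.le (i := w ⟨0, hk⟩)
        (Nat.pos_of_ne_zero fun h => hc (Fin.ext h)), fill] at h6
      rw [depth_zero] at h7
      simp only [Equiv.symm_apply_apply, depth_zero, sub_zero] at h6
      rw [max_min_of_mem h0.le (by linarith)] at h6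
      linarith
    refine hw 1 one_pos hn ?_
    have h8 : {i : Fin n | i.val < 1} = {⟨0, hk⟩} := by
      ext i; simp [Fin.ext_iff]
    rw [h8, Set.image_singleton, hw0]
  · have hcard : ∀ r, r ≤ n → (Finset.univ.filter fun i : Fin n => i.val < r).card = r := by
      intro r hr
      rw [Fin.card_filter_val_lt, min_eq_right hr]
    have hcardw : ∀ r, r ≤ n →
        (Finset.univ.filter fun i : Fin n => (w.symm i).val < r).card = r := by
      intro r hr
      rw [Finset.card_equiv w.symm (t := Finset.univ.filter fun i : Fin n => i.val < r) (by simp),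
        hcard r hr]
    have h6 : (Finset.univ.filter fun i : Fin n => i.val < j) ⊆
        Finset.univ.filter fun i : Fin n => (w.symm i).val < k := by
      intro i hi; simp at hi ⊢; exact hA i hi
    have h7 : (Finset.univ.filter fun i : Fin n => (w.symm i).val < k) ⊆
        Finset.univ.filter fun i : Fin n => i.val < j + 1 := by
      intro i hi; simp at hi ⊢; have := hB i hi; omega
    have c6 := Finset.card_le_card h6
    have c7 := Finset.card_le_card h7
    rw [hcard j hj.le, hcardw k hk.le] at c6
    rw [hcard (j + 1) hj, hcardw k hk.le] at c7
    obtain rfl | rfl : k = j ∨ k = j + 1 := by omega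
    · have := Finset.eq_of_subset_of_card_le h6 (by rw [hcard k hk.le, hcardw k hk.le])
      exact hw k hk0 hk (himg k hk.le fun i => by simpa using Finset.ext_iff.1 this i)
    · have := Finset.eq_of_subset_of_card_le h7 (by rw [hcard _ hk.le, hcardw _ hk.le])
      exact hw _ hk0 hk (himg _ hk.le fun i => by simpa using (Finset.ext_iff.1 this i).symm)

/-! ### Tiles as regions between two functions of depth -/

/-- The depth of the top vertex of a tile. -/
def Tile.upper (t : Tile n) : ℝ := -t.top.im

/-- The depth of the bottom vertex of a tile. -/
def Tile.lower (θ : Fin n → ℝ) (t : Tile n) : ℝ := t.upper + drop θ t.a + drop θ t.b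

/-- The horizontal coordinate of the left boundary of a tile at depth `d`. -/
def Tile.left (θ : Fin n → ℝ) (t : Tile n) (d : ℝ) : ℝ :=
  t.top.re + slope θ t.a * (d - t.upper) +
    (slope θ t.b - slope θ t.a) * max 0 (d - t.upper - drop θ t.a)

/-- The horizontal coordinate of the right boundary of a tile at depth `d`. -/
def Tile.right (θ : Fin n → ℝ) (t : Tile n) (d : ℝ) : ℝ :=
  t.top.re + slope θ t.a * (d - t.upper) +
    (slope θ t.b - slope θ t.a) * min (drop θ t.b) (d - t.upper)

theorem Tile.continuous_left (t : Tile n) : Continuous (t.left θ) := by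
  unfold Tile.left; fun_prop

theorem Tile.continuous_right (t : Tile n) : Continuous (t.right θ) := by
  unfold Tile.right; fun_prop

theorem Tile.slope_sub_pos (hθ : IsAdmissible θ) (t : Tile n) :
    0 < slope θ t.b - slope θ t.a := sub_pos.2 (hθ.slope_strictMono t.a_lt_b)

theorem Tile.upper_lt_lower (hθ : IsAdmissible θ) (t : Tile n) : t.upper < t.lower θ := by
  have := hθ.drop_pos t.a
  have := hθ.drop_pos t.b
  rw [Tile.lower]; linarith

theorem Tile.left_lt_right (hθ : IsAdmissible θ) (t : Tile n) {d : ℝ} (h0 : t.upper < d)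
    (h1 : d < t.lower θ) : t.left θ d < t.right θ d := by
  have ha := hθ.drop_pos t.a
  have hb := hθ.drop_pos t.b
  rw [Tile.lower] at h1
  refine add_lt_add_right (mul_lt_mul_of_pos_left ?_ (t.slope_sub_pos hθ)) _
  rw [lt_min_iff, max_lt_iff, max_lt_iff]
  refine ⟨⟨?_, ?_⟩, ?_, ?_⟩ <;> linarith

theorem Tile.mem_carrier (hθ : IsAdmissible θ) (t : Tile n) (z : ℂ) :
    z ∈ t.carrier θ ↔ t.upper ≤ -z.im ∧ -z.im ≤ t.lower θ ∧
      t.left θ (-z.im) ≤ z.re ∧ z.re ≤ t.right θ (-z.im) := by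
  have ha := hθ.drop_pos t.a
  have hb := hθ.drop_pos t.b
  have hs := t.slope_sub_pos hθ
  have hca := hθ.slope_mul_drop t.a
  have hcb := hθ.slope_mul_drop t.b
  constructor
  · rintro ⟨r, ⟨hr0, hr1⟩, s, ⟨hs0, hs1⟩, rfl⟩
    have him : -(t.top + r • edgeVec θ t.a + s • edgeVec θ t.b).im - t.upper =
        r * drop θ t.a + s * drop θ t.b := by
      simp [Tile.upper]; ring
    have hre : (t.top + r • edgeVec θ t.a + s • edgeVec θ t.b).re = t.top.re +
        slope θ t.a * (r * drop θ t.a + s * drop θ t.b) +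
          (slope θ t.b - slope θ t.a) * (s * drop θ t.b) := by
      simp [← hca, ← hcb]; ring
    have h1 : r * drop θ t.a ≤ drop θ t.a := mul_le_of_le_one_left ha.le hr1
    have h2 : s * drop θ t.b ≤ drop θ t.b := mul_le_of_le_one_left hb.le hs1
    have h3 : 0 ≤ r * drop θ t.a := by positivity
    have h4 : 0 ≤ s * drop θ t.b := by positivity
    refine ⟨by linarith, by rw [Tile.lower]; linarith, ?_, ?_⟩
    · rw [Tile.left, him, hre]
      refine add_le_add_right (mul_le_mul_of_nonneg_left (max_le h4 ?_) hs.le) _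
      linarith
    · rw [Tile.right, him, hre]
      refine add_le_add_right (mul_le_mul_of_nonneg_left (le_min h2 ?_) hs.le) _
      linarith
  · rintro ⟨h0, h1, h2, h3⟩
    rw [Tile.lower] at h1
    -- `μ` is the depth travelled along label `b`, that is `s * drop θ t.b`. The conditions `0 ≤ r,
    -- s ≤ 1` read `max 0 (δ - drop θ t.a) ≤ μ ≤ min (drop θ t.b) δ`, with `δ` the depth below the
    -- top of the tile.
    obtain ⟨μ, hμ⟩ : ∃ μ, z.re = t.top.re + slope θ t.a * (-z.im - t.upper) +
        (slope θ t.b - slope θ t.a) * μ :=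
      ⟨(z.re - (t.top.re + slope θ t.a * (-z.im - t.upper))) / (slope θ t.b - slope θ t.a), by
        rw [mul_div_cancel₀ _ hs.ne']; ring⟩
    rw [Tile.left, hμ] at h2
    rw [Tile.right, hμ] at h3
    have h2' := max_le_iff.1 (le_of_mul_le_mul_left (le_of_add_le_add_left h2) hs)
    have h3' := le_min_iff.1 (le_of_mul_le_mul_left (le_of_add_le_add_left h3) hs)
    refine ⟨(-z.im - t.upper - μ) / drop θ t.a, ⟨div_nonneg (by linarith) ha.le, ?_⟩,
      μ / drop θ t.b, ⟨div_nonneg h2'.1 hb.le, ?_⟩, ?_⟩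
    · rw [div_le_one ha]; linarith
    · rw [div_le_one hb]; exact h3'.1
    · apply Complex.ext
      · simp only [Complex.add_re, Complex.smul_re, edgeVec_re, ← hca, ← hcb, smul_eq_mul, hμ]
        field_simp; ring
      · simp only [Complex.add_im, Complex.smul_im, edgeVec_im, smul_eq_mul, Tile.upper]
        field_simp; ring

theorem Tile.mem_interior_carrier (hθ : IsAdmissible θ) (t : Tile n) (z : ℂ) :
    z ∈ interior (t.carrier θ) ↔ (t.upper < -z.im ∧ -z.im < t.lower θ) ∧
      t.left θ (-z.im) < z.re ∧ z.re < t.right θ (-z.im) := by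
  constructor
  · intro h
    rw [mem_interior_iff_mem_nhds, Metric.mem_nhds_iff] at h
    obtain ⟨ε, hε, h⟩ := h
    -- Horizontal moves keep the depth and make the left and right bounds strict; vertical moves do
    -- this for the upper and lower bounds.
    have key : ∀ v : ℂ, ‖v‖ = 1 → z + (ε / 2) • v ∈ t.carrier θ := by
      intro v hv
      apply h
      rw [Metric.mem_ball, dist_eq_norm, add_sub_cancel_left, norm_smul, hv, Real.norm_eq_abs,
        abs_of_pos (by linarith)]
      linarith
    have k1 := (t.mem_carrier hθ _).1 (key 1 (by simp))
    have k2 := (t.mem_carrier hθ _).1 (key (-1) (by simp))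
    have k3 := (t.mem_carrier hθ _).1 (key Complex.I (by simp))
    have k4 := (t.mem_carrier hθ _).1 (key (-Complex.I) (by simp))
    simp at k1 k2 k3 k4
    exact ⟨⟨by linarith, by linarith⟩, by linarith, by linarith⟩
  · intro h
    refine mem_interior.2 ⟨{z | (t.upper < -z.im ∧ -z.im < t.lower θ) ∧
      t.left θ (-z.im) < z.re ∧ z.re < t.right θ (-z.im)}, ?_, ?_, h⟩
    · intro y hy
      exact (t.mem_carrier hθ y).2 ⟨hy.1.1.le, hy.1.2.le, hy.2.1.le, hy.2.2.le⟩
    · have c1 : Continuous fun z : ℂ => -z.im := Complex.continuous_im.neg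
      exact ((isOpen_lt continuous_const c1).inter (isOpen_lt c1 continuous_const)).inter
        ((isOpen_lt (t.continuous_left.comp c1) Complex.continuous_re).inter
          (isOpen_lt Complex.continuous_re (t.continuous_right.comp c1)))

theorem Tile.isClosed_carrier (hθ : IsAdmissible θ) (t : Tile n) : IsClosed (t.carrier θ) := by
  have c1 : Continuous fun z : ℂ => -z.im := Complex.continuous_im.neg
  have : t.carrier θ = {z | t.upper ≤ -z.im} ∩ ({z | -z.im ≤ t.lower θ} ∩
      ({z | t.left θ (-z.im) ≤ z.re} ∩ {z | z.re ≤ t.right θ (-z.im)})) :=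
    Set.ext (t.mem_carrier hθ)
  rw [this]
  exact (isClosed_le continuous_const c1).inter ((isClosed_le c1 continuous_const).inter
    ((isClosed_le (t.continuous_left.comp c1) Complex.continuous_re).inter
      (isClosed_le Complex.continuous_re (t.continuous_right.comp c1))))

/-! ### Exchanging adjacent edges, and the tile at a descent -/

/-- The permutation `w` with its values in positions `k` and `k + 1` exchanged. -/
def swapAt (w : Equiv.Perm (Fin n)) (k : ℕ) (hk : k + 1 < n) : Equiv.Perm (Fin n) :=
  w * Equiv.swap ⟨k, by omega⟩ ⟨k + 1, hk⟩

/-- `w` has a descent in position `k`. -/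
def IsDescent (w : Equiv.Perm (Fin n)) (k : ℕ) (hk : k + 1 < n) : Prop :=
  w ⟨k + 1, hk⟩ < w ⟨k, by omega⟩

/-- The tile below the `k`-th vertex of the path whose right boundary consists of the edges `k`
and `k + 1` of the path. -/
def tileAt (θ : Fin n → ℝ) (w : Equiv.Perm (Fin n)) (k : ℕ) (hk : k + 1 < n)
    (hd : IsDescent w k hk) : Tile n :=
  ⟨pathVertex θ w k, w ⟨k + 1, hk⟩, w ⟨k, by omega⟩, hd⟩

section swap

variable (w : Equiv.Perm (Fin n)) {k : ℕ} (hk : k + 1 < n)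

@[simp] theorem swapAt_left : swapAt w k hk ⟨k, by omega⟩ = w ⟨k + 1, hk⟩ := by simp [swapAt]

@[simp] theorem swapAt_right : swapAt w k hk ⟨k + 1, hk⟩ = w ⟨k, by omega⟩ := by simp [swapAt]

theorem swapAt_of_ne {i : Fin n} (h0 : i.val ≠ k) (h1 : i.val ≠ k + 1) :
    swapAt w k hk i = w i := by
  simp [swapAt, Equiv.swap_apply_of_ne_of_ne (a := (⟨k, by omega⟩ : Fin n)) (b := ⟨k + 1, hk⟩)
    (fun h => h0 (congrArg Fin.val h)) (fun h => h1 (congrArg Fin.val h))]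

theorem pathVertex_swapAt {j : ℕ} (hj : j ≠ k + 1) :
    pathVertex θ (swapAt w k hk) j = pathVertex θ w j := by
  refine pathVertex_mul w _ j fun i => ?_
  rw [Equiv.swap_apply_def]
  split_ifs with h1 h2
  · subst h1; simp; omega
  · subst h2; simp; omega
  · rfl

theorem depth_swapAt {j : ℕ} (hj : j ≠ k + 1) : depth θ (swapAt w k hk) j = depth θ w j := by
  rw [depth, depth, pathVertex_swapAt w hk hj]

theorem depth_add_two : depth θ w (k + 2) =
    depth θ w k + drop θ (w ⟨k, by omega⟩) + drop θ (w ⟨k + 1, hk⟩) := by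
  rw [depth_succ w hk, depth_succ w (by omega : k < n)]

variable (hθ : IsAdmissible θ)
include hθ

theorem profile_depth {j : ℕ} (hj : j ≤ n) :
    profile θ w (depth θ w j) = (pathVertex θ w j).re := by
  rcases hj.lt_or_eq with h | rfl
  · rw [profile_eq hθ w h le_rfl (depth_le hθ w (Nat.le_succ j) h)]; ring
  · rcases Nat.eq_zero_or_pos j with rfl | h
    · simp [profile, pathVertex]
    · obtain ⟨i, rfl⟩ := Nat.exists_eq_succ_of_ne_zero h.ne'
      rw [profile_eq hθ w (Nat.lt_succ_self i) (depth_le hθ w (Nat.le_succ i) le_rfl) le_rfl,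
        pathVertex_succ w (Nat.lt_succ_self i), depth_succ w (Nat.lt_succ_self i)]
      simp [hθ.slope_mul_drop]

theorem profile_swapAt {d : ℝ} (h0 : 0 ≤ d) (h1 : d ≤ depth θ 1 n)
    (h : d ≤ depth θ w k ∨ depth θ w (k + 2) ≤ d) :
    profile θ (swapAt w k hk) d = profile θ w d := by
  have hv : ∀ j, j ≤ n → j ≠ k + 1 → d = depth θ w j →
      profile θ (swapAt w k hk) d = profile θ w d := by
    rintro j hj hjk rfl
    rw [profile_depth w hθ hj, ← depth_swapAt w hk hjk, profile_depth _ hθ hj,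
      pathVertex_swapAt w hk hjk]
  rcases h1.eq_or_lt with rfl | h1
  · exact hv n le_rfl hk.ne' (depth_last w).symm
  obtain ⟨j, hj, h2, h3⟩ := exists_window w h0 h1
  by_cases hjk : j = k
  · subst hjk
    rcases h with h | h
    · exact hv j hj.le (by omega) (le_antisymm h h2)
    · linarith [depth_lt hθ w (Nat.lt_succ_self (j + 1)) hk]
  by_cases hjk' : j = k + 1
  · subst hjk'
    rcases h with h | h
    · exact absurd (depth_lt hθ w (Nat.lt_succ_self k) (by omega)) (by simp; linarith)
    · exact absurd h3 (not_lt.2 h)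
  have e1 := depth_swapAt (θ := θ) w hk hjk'
  have e2 := depth_swapAt (θ := θ) w hk (j := j + 1) (by omega)
  rw [profile_eq hθ w hj h2 h3.le, profile_eq hθ _ hj (by rwa [e1]) (by rw [e2]; exact h3.le), e1,
    pathVertex_swapAt w hk hjk', swapAt_of_ne w hk (by simpa) (by simpa)]

/-- This is the formula of `Tile.right` for the tile with sides `k`, `k + 1`. No descent is assumed,
so it also applies after the exchange, where it yields the left side of the tile. -/
theorem profile_two_edges {d : ℝ} (h0 : depth θ w k ≤ d) (h1 : d ≤ depth θ w (k + 2)) :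
    profile θ w d = (pathVertex θ w k).re + slope θ (w ⟨k + 1, hk⟩) * (d - depth θ w k) +
      (slope θ (w ⟨k, by omega⟩) - slope θ (w ⟨k + 1, hk⟩)) *
        min (drop θ (w ⟨k, by omega⟩)) (d - depth θ w k) := by
  have hk' : k < n := by omega
  have e := depth_succ (θ := θ) w hk'
  rcases le_total d (depth θ w (k + 1)) with h | h
  · rw [profile_eq hθ w hk' h0 h, min_eq_right (by linarith)]; ring
  · rw [profile_eq hθ w hk h h1, min_eq_left (by linarith), pathVertex_succ w hk', e,
      Complex.add_re, edgeVec_re, ← hθ.slope_mul_drop]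
    ring

variable (hd : IsDescent w k hk)

omit hθ in
theorem upper_tileAt : (tileAt θ w k hk hd).upper = depth θ w k := rfl

omit hθ in
theorem lower_tileAt : (tileAt θ w k hk hd).lower θ = depth θ w (k + 2) := by
  rw [depth_add_two w hk, Tile.lower, upper_tileAt]; simp only [tileAt]; ring

theorem right_tileAt {d : ℝ} (h0 : depth θ w k ≤ d) (h1 : d ≤ depth θ w (k + 2)) :
    (tileAt θ w k hk hd).right θ d = profile θ w d := by
  rw [profile_two_edges w hk hθ h0 h1]; rfl

theorem left_tileAt {d : ℝ} (h0 : depth θ w k ≤ d) (h1 : d ≤ depth θ w (k + 2)) :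
    (tileAt θ w k hk hd).left θ d = profile θ (swapAt w k hk) d := by
  have e0 := depth_swapAt (θ := θ) w hk (j := k) (by omega)
  have e2 := depth_swapAt (θ := θ) w hk (j := k + 2) (by omega)
  rw [profile_two_edges _ hk hθ (by rwa [e0]) (by rwa [e2]), e0, swapAt_left, swapAt_right,
    pathVertex_swapAt w hk (by omega), Tile.left, upper_tileAt]
  simp only [tileAt]
  have : min (drop θ (w ⟨k + 1, hk⟩)) (d - depth θ w k) =
      d - depth θ w k - max 0 (d - depth θ w k - drop θ (w ⟨k + 1, hk⟩)) := by
    rcases le_total (d - depth θ w k) (drop θ (w ⟨k + 1, hk⟩)) with h | h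
    · rw [min_eq_right h, max_eq_left (by linarith)]; ring
    · rw [min_eq_left h, max_eq_right (by linarith)]; ring
  rw [this]; ring

include hd in
theorem profile_swapAt_le {d : ℝ} (h0 : 0 ≤ d) (h1 : d ≤ depth θ 1 n) :
    profile θ (swapAt w k hk) d ≤ profile θ w d := by
  by_cases h : d ≤ depth θ w k ∨ depth θ w (k + 2) ≤ d
  · exact (profile_swapAt w hk hθ h0 h1 h).le
  · push Not at h
    rw [← left_tileAt w hk hθ hd h.1.le h.2.le, ← right_tileAt w hk hθ hd h.1.le h.2.le]
    exact ((tileAt θ w k hk hd).left_lt_right hθ h.1 (by rw [lower_tileAt]; exact h.2)).le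

end swap

/-! ### Tilings and dissections by horizontal slices -/

/-- The tiles of `T` dissect the region between the two boundary paths, up to boundary points:
on each horizontal line they cut out nonoverlapping intervals that fill the region. -/
structure Dissects (θ : Fin n → ℝ) (w : Equiv.Perm (Fin n)) (T : Finset (Tile n)) : Prop where
  inside : ∀ t ∈ T, ∀ d, t.upper ≤ d → d ≤ t.lower θ →
    (0 ≤ d ∧ d ≤ depth θ 1 n) ∧ profile θ 1 d ≤ t.left θ d ∧ t.right θ d ≤ profile θ w d
  covers : ∀ d x, 0 ≤ d → d ≤ depth θ 1 n → profile θ 1 d < x → x < profile θ w d →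
    ∃ t ∈ T, (t.upper ≤ d ∧ d ≤ t.lower θ) ∧ t.left θ d ≤ x ∧ x ≤ t.right θ d
  disjoint : ∀ s ∈ T, ∀ t ∈ T, s ≠ t → ∀ d, s.upper < d → d < s.lower θ → t.upper < d →
    d < t.lower θ → s.right θ d ≤ t.left θ d ∨ t.right θ d ≤ s.left θ d

theorem IsTiling.dissects (hθ : IsAdmissible θ) (hn : 0 < n) {w : Equiv.Perm (Fin n)}
    {T : Finset (Tile n)} (h : IsTiling θ w T) : Dissects θ w T where
  inside t ht d h0 h1 := by
    have hlr : t.left θ d ≤ t.right θ d := by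
      have hcl : d ∈ closure (Set.Ioo t.upper (t.lower θ)) := by
        rw [closure_Ioo (t.upper_lt_lower hθ).ne]; exact ⟨h0, h1⟩
      exact le_on_closure (f := t.left θ) (g := t.right θ)
        (fun x hx => (t.left_lt_right hθ hx.1 hx.2).le)
        t.continuous_left.continuousOn t.continuous_right.continuousOn hcl
    have hsub : ∀ z ∈ t.carrier θ, z ∈ polygon θ w := fun z hz => by
      rw [← h.2]; exact Set.mem_biUnion ht hz
    have h2 := (mem_polygon hθ hn w _).1 (hsub ⟨t.left θ d, -d⟩
      ((t.mem_carrier hθ _).2 (by simpa using And.intro h0 (And.intro h1 hlr))))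
    have h3 := (mem_polygon hθ hn w _).1 (hsub ⟨t.right θ d, -d⟩
      ((t.mem_carrier hθ _).2 (by simpa using And.intro h0 (And.intro h1 hlr))))
    simp only [neg_neg] at h2 h3
    exact ⟨⟨h2.1, h2.2.1⟩, h2.2.2.1, h3.2.2.2⟩
  covers d x h0 h1 h2 h3 := by
    have hz : (⟨x, -d⟩ : ℂ) ∈ polygon θ w :=
      (mem_polygon hθ hn w _).2 (by simpa using And.intro h0 ⟨h1, h2.le, h3.le⟩)
    rw [← h.2] at hz
    obtain ⟨t, ht, hz⟩ := Set.mem_iUnion₂.1 hz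
    have := (t.mem_carrier hθ _).1 hz
    simp only [neg_neg] at this
    exact ⟨t, ht, ⟨this.1, this.2.1⟩, this.2.2⟩
  disjoint s hs t ht hst d h0 h1 h2 h3 := by
    by_contra hc
    push Not at hc
    -- Two overlapping slices at a common depth would give a point interior to both rhombi.
    obtain ⟨x, hx0, hx1⟩ : ∃ x, max (s.left θ d) (t.left θ d) < x ∧
        x < min (s.right θ d) (t.right θ d) :=
      exists_between (max_lt (lt_min (s.left_lt_right hθ h0 h1) hc.2)
        (lt_min hc.1 (t.left_lt_right hθ h2 h3)))
    rw [max_lt_iff] at hx0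
    rw [lt_min_iff] at hx1
    have hxs : (⟨x, -d⟩ : ℂ) ∈ interior (s.carrier θ) := (s.mem_interior_carrier hθ _).2
      (by simpa using And.intro (And.intro h0 h1) (And.intro hx0.1 hx1.1))
    have hxt : (⟨x, -d⟩ : ℂ) ∈ interior (t.carrier θ) := (t.mem_interior_carrier hθ _).2
      (by simpa using And.intro (And.intro h2 h3) (And.intro hx0.2 hx1.2))
    exact Set.disjoint_left.1 (h.1 hs ht hst) hxs hxt

/-- A dissection covers only the open slices, and the union of its tiles is closed. Full support
makes all slices strictly between top and bottom nondegenerate, so their endpoints are limits of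
covered points; the top and bottom vertices are then limits along the leftside boundary. -/
theorem Dissects.isTiling (hθ : IsAdmissible θ) (hn : 1 < n) {w : Equiv.Perm (Fin n)}
    (hw : FullySupported w) {T : Finset (Tile n)} (h : Dissects θ w T) : IsTiling θ w T := by
  have hn0 : 0 < n := by omega
  refine ⟨fun s hs t ht hst => Set.disjoint_left.2 fun z hz hz' => ?_, Set.Subset.antisymm ?_ ?_⟩
  · rw [Tile.mem_interior_carrier hθ] at hz hz'
    rcases h.disjoint s hs t ht hst _ hz.1.1 hz.1.2 hz'.1.1 hz'.1.2 with h1 | h1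
    · linarith [hz.2.2, hz'.2.1]
    · linarith [hz.2.1, hz'.2.2]
  · refine Set.iUnion₂_subset fun t ht z hz => ?_
    rw [Tile.mem_carrier hθ] at hz
    obtain ⟨h1, h2, h3⟩ := h.inside t ht _ hz.1 hz.2.1
    exact (mem_polygon hθ hn0 w z).2 ⟨h1.1, h1.2, h2.trans hz.2.2.1, hz.2.2.2.trans h3⟩
  · have hcl : IsClosed (⋃ t ∈ T, t.carrier θ) :=
      T.finite_toSet.isClosed_biUnion fun t _ => t.isClosed_carrier hθ
    have hH : 0 < depth θ 1 n := by
      rw [← depth_zero (θ := θ) 1]; exact depth_lt hθ 1 hn0 le_rfl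
    have hcov : ∀ d x, 0 ≤ d → d ≤ depth θ 1 n → profile θ 1 d < x → x < profile θ w d →
        (⟨x, -d⟩ : ℂ) ∈ ⋃ t ∈ T, t.carrier θ := by
      intro d x h0 h1 h2 h3
      obtain ⟨t, ht, h4, h5⟩ := h.covers d x h0 h1 h2 h3
      exact Set.mem_biUnion ht ((t.mem_carrier hθ _).2
        (by simpa using And.intro h4.1 (And.intro h4.2 h5)))
    have hrow : ∀ d x, 0 < d → d < depth θ 1 n → profile θ 1 d ≤ x → x ≤ profile θ w d →
        (⟨x, -d⟩ : ℂ) ∈ ⋃ t ∈ T, t.carrier θ := by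
      intro d x h0 h1 h2 h3
      have hx : x ∈ closure (Set.Ioo (profile θ 1 d) (profile θ w d)) := by
        rw [closure_Ioo (hw.profile_one_lt hθ hn h0 h1).ne]; exact ⟨h2, h3⟩
      have hc : Continuous fun x : ℝ => (⟨x, -d⟩ : ℂ) := by
        have : (fun x : ℝ => (⟨x, -d⟩ : ℂ)) = fun x : ℝ => (x : ℂ) + ((-d : ℝ) : ℂ) * Complex.I :=
          funext fun x => Complex.mk_eq_add_mul_I _ _
        rw [this]; fun_prop
      have hm : Set.MapsTo (fun x : ℝ => (⟨x, -d⟩ : ℂ))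
          (Set.Ioo (profile θ 1 d) (profile θ w d)) (⋃ t ∈ T, t.carrier θ) :=
        fun y hy => hcov d y h0.le h1.le hy.1 hy.2
      exact hcl.closure_eq ▸ hm.closure hc hx
    have hends : ∀ d, (d = 0 ∨ d = depth θ 1 n) → profile θ 1 d = profile θ w d := by
      rintro d (rfl | rfl)
      · have h1 := profile_depth (θ := θ) w hθ (Nat.zero_le n)
        have h2 := profile_depth (θ := θ) 1 hθ (Nat.zero_le n)
        rw [depth_zero, pathVertex_zero] at h1 h2
        rw [h1, h2]
      · have h1 := profile_depth (θ := θ) w hθ le_rfl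
        rw [depth_last] at h1
        rw [h1, profile_depth 1 hθ le_rfl, ← pathVertex_mul 1 w n (by simp), one_mul]
    intro z hz
    obtain ⟨h0, h1, h2, h3⟩ := (mem_polygon hθ hn0 w z).1 hz
    by_cases hz' : -z.im = 0 ∨ -z.im = depth θ 1 n
    · have hre : z.re = profile θ 1 (-z.im) := le_antisymm (h3.trans (hends _ hz').ge) h2
      have hc : Continuous fun d : ℝ => (⟨profile θ 1 d, -d⟩ : ℂ) := by
        have : (fun d : ℝ => (⟨profile θ 1 d, -d⟩ : ℂ)) =
            fun d : ℝ => ((profile θ 1 d : ℝ) : ℂ) + ((-d : ℝ) : ℂ) * Complex.I :=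
          funext fun x => Complex.mk_eq_add_mul_I _ _
        rw [this]
        have := continuous_profile (θ := θ) 1
        fun_prop
      have hm : Set.MapsTo (fun d : ℝ => (⟨profile θ 1 d, -d⟩ : ℂ))
          (Set.Ioo 0 (depth θ 1 n)) (⋃ t ∈ T, t.carrier θ) :=
        fun y hy => hrow y _ hy.1 hy.2 le_rfl (profile_one_le hθ w hy.1.le hy.2.le)
      have hd : -z.im ∈ closure (Set.Ioo 0 (depth θ 1 n)) := by
        rw [closure_Ioo hH.ne]; exact ⟨h0, h1⟩
      have := hm.closure hc hd
      rw [hcl.closure_eq] at this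
      simp only [← hre, neg_neg] at this
      exact this
    · push Not at hz'
      have := hrow (-z.im) z.re (lt_of_le_of_ne h0 hz'.1.symm) (lt_of_le_of_ne h1 hz'.2) h2 h3
      rwa [neg_neg] at this

theorem Dissects.eq_of_right_eq (hθ : IsAdmissible θ) {w : Equiv.Perm (Fin n)}
    {T : Finset (Tile n)} (h : Dissects θ w T) {s t : Tile n} (hs : s ∈ T) (ht : t ∈ T) {d : ℝ}
    (h0 : s.upper < d) (h1 : d < s.lower θ) (h2 : t.upper < d) (h3 : d < t.lower θ)
    (h4 : s.right θ d = t.right θ d) : s = t := by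
  by_contra hst
  have h5 := s.left_lt_right hθ h0 h1
  have h6 := t.left_lt_right hθ h2 h3
  rcases h.disjoint s hs t ht hst d h0 h1 h2 h3 with h7 | h7 <;> linarith

/-! ### Gluing on and removing the tile at a descent -/

open Classical in
theorem Dissects.insert (hθ : IsAdmissible θ) {w : Equiv.Perm (Fin n)} {k : ℕ} {hk : k + 1 < n}
    (hd : IsDescent w k hk) {T : Finset (Tile n)} (h : Dissects θ (swapAt w k hk) T) :
    Dissects θ w (insert (tileAt θ w k hk hd) T) where
  inside t ht d h0 h1 := by
    rcases Finset.mem_insert.1 ht with rfl | ht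
    · rw [upper_tileAt] at h0
      rw [lower_tileAt] at h1
      have h2 : 0 ≤ d := (depth_nonneg hθ w (by omega)).trans h0
      have h3 : d ≤ depth θ 1 n := h1.trans (depth_le_last hθ w (by omega))
      rw [left_tileAt w hk hθ hd h0 h1, right_tileAt w hk hθ hd h0 h1]
      exact ⟨⟨h2, h3⟩, profile_one_le hθ _ h2 h3, le_rfl⟩
    · obtain ⟨h2, h3, h4⟩ := h.inside t ht d h0 h1
      exact ⟨h2, h3, h4.trans (profile_swapAt_le w hk hθ hd h2.1 h2.2)⟩
  covers d x h0 h1 h2 h3 := by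
    rcases lt_or_ge x (profile θ (swapAt w k hk) d) with h4 | h4
    · obtain ⟨t, ht, h5⟩ := h.covers d x h0 h1 h2 h4
      exact ⟨t, Finset.mem_insert_of_mem ht, h5⟩
    · have h5 : ¬(d ≤ depth θ w k ∨ depth θ w (k + 2) ≤ d) := fun h5 => by
        rw [profile_swapAt w hk hθ h0 h1 h5] at h4; linarith
      push Not at h5
      refine ⟨_, Finset.mem_insert_self _ _, ⟨h5.1.le, by rw [lower_tileAt]; exact h5.2.le⟩, ?_, ?_⟩
      · rwa [left_tileAt w hk hθ hd h5.1.le h5.2.le]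
      · rw [right_tileAt w hk hθ hd h5.1.le h5.2.le]; exact h3.le
  disjoint s hs t ht hst d h0 h1 h2 h3 := by
    have key : ∀ t ∈ T, t.upper < d → d < t.lower θ → (tileAt θ w k hk hd).upper < d →
        d < (tileAt θ w k hk hd).lower θ → t.right θ d ≤ (tileAt θ w k hk hd).left θ d := by
      intro t ht h4 h5 h6 h7
      rw [lower_tileAt] at h7
      rw [left_tileAt w hk hθ hd h6.le h7.le]
      exact (h.inside t ht d h4.le h5.le).2.2
    rcases Finset.mem_insert.1 hs with rfl | hs <;> rcases Finset.mem_insert.1 ht with rfl | ht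
    · exact absurd rfl hst
    · exact Or.inr (key t ht h2 h3 h0 h1)
    · exact Or.inl (key s hs h0 h1 h2 h3)
    · exact h.disjoint s hs t ht hst d h0 h1 h2 h3

open Classical in
theorem Dissects.erase (hθ : IsAdmissible θ) {w : Equiv.Perm (Fin n)} {k : ℕ} {hk : k + 1 < n}
    (hd : IsDescent w k hk) {T : Finset (Tile n)} (h : Dissects θ w T)
    (hT : tileAt θ w k hk hd ∈ T) :
    Dissects θ (swapAt w k hk) (T.erase (tileAt θ w k hk hd)) where
  inside t ht d h0 h1 := by
    obtain ⟨hne, ht⟩ := Finset.mem_erase.1 ht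
    obtain ⟨h2, h3, -⟩ := h.inside t ht d h0 h1
    refine ⟨h2, h3, ?_⟩
    have hcl : d ∈ closure (Set.Ioo t.upper (t.lower θ)) := by
      rw [closure_Ioo (t.upper_lt_lower hθ).ne]; exact ⟨h0, h1⟩
    refine le_on_closure (f := t.right θ) (g := profile θ (swapAt w k hk)) (fun x hx => ?_)
      t.continuous_right.continuousOn (continuous_profile _).continuousOn hcl
    obtain ⟨h4, h5, h6⟩ := h.inside t ht x hx.1.le hx.2.le
    by_cases h7 : x ≤ depth θ w k ∨ depth θ w (k + 2) ≤ x
    · rwa [profile_swapAt w hk hθ h4.1 h4.2 h7]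
    · push Not at h7
      -- The removed tile reaches the right boundary here, so no other tile fits to its right.
      have h8 := h.disjoint t ht _ hT hne x hx.1 hx.2 h7.1 (by rw [lower_tileAt]; exact h7.2)
      rw [left_tileAt w hk hθ hd h7.1.le h7.2.le, right_tileAt w hk hθ hd h7.1.le h7.2.le] at h8
      rcases h8 with h8 | h8
      · exact h8
      · linarith [t.left_lt_right hθ hx.1 hx.2]
  covers d x h0 h1 h2 h3 := by
    obtain ⟨t, ht, h4, h5⟩ :=
      h.covers d x h0 h1 h2 (h3.trans_le (profile_swapAt_le w hk hθ hd h0 h1))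
    refine ⟨t, Finset.mem_erase.2 ⟨?_, ht⟩, h4, h5⟩
    rintro rfl
    rw [upper_tileAt, lower_tileAt] at h4
    rw [left_tileAt w hk hθ hd h4.1 h4.2] at h5
    linarith
  disjoint s hs t ht := h.disjoint s (Finset.mem_of_mem_erase hs) t (Finset.mem_of_mem_erase ht)

theorem dissects_one : Dissects θ 1 ∅ where
  inside t ht := absurd ht (Finset.notMem_empty t)
  covers _ _ _ _ h2 h3 := absurd h2 h3.not_gt
  disjoint s hs := absurd hs (Finset.notMem_empty s)

theorem eq_one_of_forall_not_isDescent (w : Equiv.Perm (Fin n))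
    (h : ∀ k hk, ¬ IsDescent w k hk) : w = 1 := by
  have hm : StrictMono w := by
    cases n with
    | zero => exact fun i => i.elim0
    | succ n =>
      rw [Fin.strictMono_iff_lt_succ]
      intro i
      refine lt_of_le_of_ne (not_lt.1 (h i (by omega))) ?_
      exact fun he => absurd (w.injective he) (Fin.castSucc_lt_succ).ne
  ext i
  have := Subsingleton.elim (hm.orderIsoOfSurjective w w.surjective) (OrderIso.refl (Fin n))
  exact congrArg Fin.val (DFunLike.congr_fun this i)

/-- A weight that decreases when a descent is removed. -/
def disorder (w : Equiv.Perm (Fin n)) : ℕ := ∑ i : Fin n, (n - i.val) * (w i).val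

theorem disorder_swapAt_lt (w : Equiv.Perm (Fin n)) {k : ℕ} (hk : k + 1 < n)
    (hd : IsDescent w k hk) : disorder (swapAt w k hk) < disorder w := by
  have hne : (⟨k + 1, hk⟩ : Fin n) ∈ Finset.univ.erase (⟨k, by omega⟩ : Fin n) := by
    simp [Fin.ext_iff]
  have key : ∀ v : Equiv.Perm (Fin n), disorder v =
      (n - k) * (v ⟨k, by omega⟩).val + ((n - (k + 1)) * (v ⟨k + 1, hk⟩).val +
        ∑ i ∈ (Finset.univ.erase (⟨k, by omega⟩ : Fin n)).erase ⟨k + 1, hk⟩,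
          (n - i.val) * (v i).val) := fun v => by
    rw [disorder, ← Finset.add_sum_erase _ _ (Finset.mem_univ (⟨k, by omega⟩ : Fin n)),
      ← Finset.add_sum_erase _ _ hne]
  rw [key, key w, swapAt_left, swapAt_right]
  have hs : ∑ i ∈ (Finset.univ.erase (⟨k, by omega⟩ : Fin n)).erase ⟨k + 1, hk⟩,
      (n - i.val) * (swapAt w k hk i).val =
      ∑ i ∈ (Finset.univ.erase (⟨k, by omega⟩ : Fin n)).erase ⟨k + 1, hk⟩,
        (n - i.val) * (w i).val := by
    refine Finset.sum_congr rfl fun i hi => ?_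
    simp [Fin.ext_iff] at hi
    rw [swapAt_of_ne w hk hi.2 hi.1]
  rw [hs]
  obtain ⟨e, he⟩ : ∃ e, n - k = (n - (k + 1)) + 1 ∧ e = n - (k + 1) := ⟨_, by omega, rfl⟩
  have hd' : (w ⟨k + 1, hk⟩).val < (w ⟨k, by omega⟩).val := hd
  rw [he.1, ← he.2]
  nlinarith

/-- Sort `w` by removing descents; each exchange contributes one tile. -/
theorem exists_dissects (hθ : IsAdmissible θ) (w : Equiv.Perm (Fin n)) :
    ∃ T, Dissects θ w T := by
  classical
  induction hN : disorder w using Nat.strong_induction_on generalizing w with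
  | _ N ih =>
    by_cases h : ∀ k hk, ¬ IsDescent w k hk
    · rw [eq_one_of_forall_not_isDescent w h]
      exact ⟨∅, dissects_one⟩
    · push Not at h
      obtain ⟨k, hk, hd⟩ := h
      obtain ⟨T, hT⟩ := ih _ (hN ▸ disorder_swapAt_lt w hk hd) _ rfl
      exact ⟨_, hT.insert hθ hd⟩

/-! ### Following the tiles along the rightside boundary -/

open Filter Topology

/-- `f` is affine with slope `α` on some interval that begins in `d₀`. -/
def RightAffine (f : ℝ → ℝ) (d₀ α : ℝ) : Prop := ∀ᶠ d in 𝓝[>] d₀, f d = f d₀ + α * (d - d₀)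

/-- Two affine germs that agree arbitrarily close to `d₀` agree at two distinct points, hence
coincide. Mere contact of a tile with the boundary is thus upgraded to a shared stretch. -/
theorem RightAffine.eq_of_frequently {f g : ℝ → ℝ} {d₀ α β : ℝ} (hf : RightAffine f d₀ α)
    (hg : RightAffine g d₀ β) (h : ∃ᶠ d in 𝓝[>] d₀, f d = g d) : f d₀ = g d₀ ∧ α = β := by
  have hfg := hf.and hg
  obtain ⟨d₁, e₁, ⟨h₁, h₁'⟩, p₁⟩ := (h.and_eventually (hfg.and self_mem_nhdsWithin)).exists
  obtain ⟨d₂, e₂, ⟨h₂, h₂'⟩, p₂⟩ :=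
    (h.and_eventually (hfg.and (Ioo_mem_nhdsGT (show d₀ < d₁ from p₁)))).exists
  rw [h₁, h₁'] at e₁
  rw [h₂, h₂'] at e₂
  have hαβ : α = β := by
    have : (α - β) * (d₁ - d₂) = 0 := by linear_combination e₁ - e₂
    rcases mul_eq_zero.1 this with h | h
    · linarith
    · linarith [p₂.2]
  subst hαβ
  exact ⟨by linarith, rfl⟩

theorem RightAffine.eventuallyEq {f g : ℝ → ℝ} {d₀ α β : ℝ} (hf : RightAffine f d₀ α)
    (hg : RightAffine g d₀ β) (h : ∃ᶠ d in 𝓝[>] d₀, f d = g d) : ∀ᶠ d in 𝓝[>] d₀, f d = g d := by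
  obtain ⟨h1, rfl⟩ := hf.eq_of_frequently hg h
  filter_upwards [hf, hg] with d h2 h3
  rw [h2, h3, h1]

theorem RightAffine.eventually_eq_or_ne {f g : ℝ → ℝ} {d₀ α β : ℝ} (hf : RightAffine f d₀ α)
    (hg : RightAffine g d₀ β) :
    (∀ᶠ d in 𝓝[>] d₀, f d = g d) ∨ ∀ᶠ d in 𝓝[>] d₀, f d ≠ g d := by
  by_cases h : ∃ᶠ d in 𝓝[>] d₀, f d = g d
  · exact Or.inl (hf.eventuallyEq hg h)
  · exact Or.inr (not_frequently.1 h)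

theorem rightAffine_of_eqOn {f : ℝ → ℝ} {d₀ α a b c : ℝ} (h0 : a ≤ d₀) (h1 : d₀ < b)
    (h : ∀ d, a ≤ d → d ≤ b → f d = c + α * (d - a)) : RightAffine f d₀ α := by
  filter_upwards [Ioo_mem_nhdsGT h1] with d hd
  rw [h d (h0.trans hd.1.le) hd.2.le, h d₀ h0 h1.le]
  ring

theorem rightAffine_profile (hθ : IsAdmissible θ) (w : Equiv.Perm (Fin n)) {k : ℕ} (hk : k < n)
    {d : ℝ} (h0 : depth θ w k ≤ d) (h1 : d < depth θ w (k + 1)) :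
    RightAffine (profile θ w) d (slope θ (w ⟨k, hk⟩)) :=
  rightAffine_of_eqOn h0 h1 fun _ h2 h3 => profile_eq hθ w hk h2 h3

theorem exists_rightAffine_profile (hθ : IsAdmissible θ) (w : Equiv.Perm (Fin n)) {d : ℝ}
    (h0 : 0 ≤ d) (h1 : d < depth θ 1 n) : ∃ α, RightAffine (profile θ w) d α := by
  obtain ⟨k, hk, h2, h3⟩ := exists_window w h0 h1
  exact ⟨_, rightAffine_profile hθ w hk h2 h3⟩

theorem Tile.rightAffine_right_of_lt (t : Tile n) {d : ℝ} (h0 : t.upper ≤ d)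
    (h1 : d < t.upper + drop θ t.b) : RightAffine (t.right θ) d (slope θ t.b) :=
  rightAffine_of_eqOn (c := t.top.re) h0 h1 fun x _ h3 => by
    rw [Tile.right, min_eq_right (by linarith)]; ring

theorem Tile.rightAffine_right_of_ge (t : Tile n) {d : ℝ} (h0 : t.upper + drop θ t.b ≤ d) :
    RightAffine (t.right θ) d (slope θ t.a) :=
  rightAffine_of_eqOn (c := t.top.re + slope θ t.b * drop θ t.b) h0 (lt_add_one d)
    fun x h2 _ => by
      rw [Tile.right, min_eq_left (by linarith)]; ring

theorem Tile.exists_rightAffine_right (t : Tile n) {d : ℝ} (h0 : t.upper ≤ d) :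
    ∃ α, RightAffine (t.right θ) d α := by
  rcases lt_or_ge d (t.upper + drop θ t.b) with h | h
  · exact ⟨_, t.rightAffine_right_of_lt h0 h⟩
  · exact ⟨_, t.rightAffine_right_of_ge h⟩

namespace Dissects

variable {w : Equiv.Perm (Fin n)} {T : Finset (Tile n)}

/-- The tiles cut this slice in finitely many closed intervals covering its interior, so one of them
contains the right endpoint. -/
theorem exists_right_eq_profile (h : Dissects θ w T) {d : ℝ} (h0 : 0 ≤ d)
    (h1 : d ≤ depth θ 1 n) (h2 : profile θ 1 d < profile θ w d) :
    ∃ t ∈ T, (t.upper ≤ d ∧ d ≤ t.lower θ) ∧ t.right θ d = profile θ w d := by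
  have hcl : IsClosed (⋃ t ∈ {t : Tile n | t ∈ T ∧ t.upper ≤ d ∧ d ≤ t.lower θ},
      Set.Icc (t.left θ d) (t.right θ d)) :=
    (T.finite_toSet.subset fun t ht => ht.1).isClosed_biUnion fun _ _ => isClosed_Icc
  have hsub : Set.Ioo (profile θ 1 d) (profile θ w d) ⊆
      ⋃ t ∈ {t : Tile n | t ∈ T ∧ t.upper ≤ d ∧ d ≤ t.lower θ},
        Set.Icc (t.left θ d) (t.right θ d) := by
    intro x hx
    obtain ⟨t, ht, h3, h4⟩ := h.covers d x h0 h1 hx.1 hx.2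
    exact Set.mem_biUnion (show t ∈ {t : Tile n | _} from ⟨ht, h3⟩) h4
  have hmem := hcl.closure_subset_iff.2 hsub
    (show profile θ w d ∈ _ by rw [closure_Ioo h2.ne]; exact ⟨h2.le, le_rfl⟩)
  obtain ⟨t, ht, h3⟩ := Set.mem_iUnion₂.1 hmem
  exact ⟨t, ht.1, ht.2, le_antisymm (h.inside t ht.1 d ht.2.1 ht.2.2).2.2 h3.2⟩

/-- There are finitely many tiles, so a single one touches the boundary at depths arbitrarily close
below `d₀`; its right side is affine there and stays on the boundary. -/
theorem exists_right_eventuallyEq (hθ : IsAdmissible θ) (h : Dissects θ w T) {d₀ : ℝ}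
    (h0 : 0 ≤ d₀) (h1 : d₀ < depth θ 1 n)
    (h2 : ∀ᶠ d in 𝓝[>] d₀, profile θ 1 d < profile θ w d) :
    ∃ t ∈ T, (t.upper ≤ d₀ ∧ d₀ < t.lower θ) ∧ t.right θ d₀ = profile θ w d₀ ∧
      ∀ᶠ d in 𝓝[>] d₀, t.right θ d = profile θ w d := by
  have h3 : ∃ᶠ d in 𝓝[>] d₀, ∃ t ∈ T, (t.upper ≤ d ∧ d ≤ t.lower θ) ∧
      t.right θ d = profile θ w d := by
    refine Eventually.frequently ?_
    filter_upwards [h2, Ioo_mem_nhdsGT h1] with d h3 h4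
    exact h.exists_right_eq_profile (h0.trans h4.1.le) h4.2.le h3
  have h4 : ∃ t ∈ T, ∃ᶠ d in 𝓝[>] d₀, (t.upper ≤ d ∧ d ≤ t.lower θ) ∧
      t.right θ d = profile θ w d := by
    by_contra hc
    have hc' : ∀ t ∈ T, ∀ᶠ d in 𝓝[>] d₀, ¬((t.upper ≤ d ∧ d ≤ t.lower θ) ∧
        t.right θ d = profile θ w d) := fun t ht => by
      by_contra h4
      exact hc ⟨t, ht, h4⟩
    refine h3 ?_
    filter_upwards [(T.eventually_all).2 hc'] with d hd
    rintro ⟨t, ht, h5⟩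
    exact hd t ht h5
  obtain ⟨t, ht, h5⟩ := h4
  have hu : t.upper ≤ d₀ := by
    by_contra hc
    obtain ⟨d, h6, h7⟩ := (h5.and_eventually (Ioo_mem_nhdsGT (not_le.1 hc))).exists
    linarith [h6.1.1, h7.2]
  have hl : d₀ < t.lower θ := by
    obtain ⟨d, h6, h7⟩ := (h5.and_eventually self_mem_nhdsWithin).exists
    exact lt_of_lt_of_le h7 h6.1.2
  obtain ⟨α, hα⟩ := t.exists_rightAffine_right (θ := θ) hu
  obtain ⟨β, hβ⟩ := exists_rightAffine_profile hθ w h0 h1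
  have h6 := h5.mono fun d hd => hd.2
  exact ⟨t, ht, ⟨hu, hl⟩, (hα.eq_of_frequently hβ h6).1, hα.eventuallyEq hβ h6⟩

/-- Some tile begins on the right boundary, unless the two boundary paths agree. -/
theorem exists_right_eventuallyEq_upper (hθ : IsAdmissible θ) (h : Dissects θ w T) {d : ℝ}
    (h0 : 0 ≤ d) (h1 : d ≤ depth θ 1 n) (h2 : profile θ 1 d < profile θ w d) :
    ∃ t ∈ T, ∀ᶠ x in 𝓝[>] t.upper, t.right θ x = profile θ w x := by
  by_contra hV
  have hsub : Set.Icc 0 (depth θ 1 n) ⊆ {x | profile θ 1 x = profile θ w x} := by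
    -- Induction over the continuum from the top vertex: if no tile began on the boundary, the two
    -- paths could never separate.
    refine IsClosed.Icc_subset_of_forall_mem_nhdsWithin ?_ ?_ ?_
    · exact (isClosed_eq (continuous_profile _) (continuous_profile _)).inter isClosed_Icc
    · have h1 := profile_depth (θ := θ) w hθ (Nat.zero_le n)
      have h2 := profile_depth (θ := θ) 1 hθ (Nat.zero_le n)
      rw [depth_zero, pathVertex_zero] at h1 h2
      exact h2.trans h1.symm
    · rintro x ⟨hx, hx0, hx1⟩
      obtain ⟨α, hα⟩ := exists_rightAffine_profile hθ 1 hx0 hx1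
      obtain ⟨β, hβ⟩ := exists_rightAffine_profile hθ w hx0 hx1
      rcases hα.eventually_eq_or_ne hβ with h3 | h3
      · exact h3
      · exfalso
        obtain ⟨t, ht, h4, h5, h6⟩ := h.exists_right_eventuallyEq hθ hx0 hx1 (by
          filter_upwards [h3, Ioo_mem_nhdsGT hx1] with y hy hy'
          exact lt_of_le_of_ne (profile_one_le hθ w (hx0.trans hy'.1.le) hy'.2.le) hy)
        rcases h4.1.eq_or_lt with h7 | h7
        · exact hV ⟨t, ht, h7 ▸ h6⟩
        -- A tile begun above `x` has positive width at `x`, where the region has width zero.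
        · obtain ⟨-, h8, h9⟩ := h.inside t ht x h7.le h4.2.le
          have := t.left_lt_right hθ h7 h4.2
          rw [Set.mem_ofPred_eq] at hx
          linarith
  exact h2.ne (hsub ⟨h0, h1⟩)

/-- Some tile has its whole right side on the right boundary: take the lowest one among those that
begin there. -/
theorem exists_right_eqOn (hθ : IsAdmissible θ) (h : Dissects θ w T) {d : ℝ}
    (h0 : 0 ≤ d) (h1 : d ≤ depth θ 1 n) (h2 : profile θ 1 d < profile θ w d) :
    ∃ t ∈ T, ∀ x ∈ Set.Icc t.upper (t.lower θ), t.right θ x = profile θ w x := by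
  classical
  obtain ⟨t₀, ht₀, hV₀⟩ := h.exists_right_eventuallyEq_upper hθ h0 h1 h2
  obtain ⟨t, ht, hmax⟩ := Finset.exists_max_image
    (T.filter fun t => ∀ᶠ x in 𝓝[>] t.upper, t.right θ x = profile θ w x) Tile.upper
    ⟨t₀, Finset.mem_filter.2 ⟨ht₀, hV₀⟩⟩
  obtain ⟨ht, hV⟩ := Finset.mem_filter.1 ht
  refine ⟨t, ht, ?_⟩
  have hlow := t.upper_lt_lower hθ
  have hin := h.inside t ht
  change Set.Icc t.upper (t.lower θ) ⊆ {x | t.right θ x = profile θ w x}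
  -- Continuous induction down the tile. The tile continuing along the boundary at `x` cannot begin
  -- there, by the choice of `t` as lowest, so it is `t` itself by disjointness.
  refine IsClosed.Icc_subset_of_forall_mem_nhdsWithin ?_ ?_ ?_
  · exact (isClosed_eq t.continuous_right (continuous_profile _)).inter isClosed_Icc
  · obtain ⟨α, hα⟩ := t.exists_rightAffine_right (θ := θ) le_rfl
    obtain ⟨β, hβ⟩ := exists_rightAffine_profile hθ w (hin _ le_rfl hlow.le).1.1
      (hlow.trans_le (hin _ hlow.le le_rfl).1.2)
    exact (hα.eq_of_frequently hβ hV.frequently).1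
  · rintro x ⟨hx, hx0, hx1⟩
    rcases hx0.eq_or_lt with rfl | hx0
    · exact hV
    obtain ⟨h3, h4, h5⟩ := hin x hx0.le hx1.le
    have h6 : profile θ 1 x < profile θ w x := by
      have := t.left_lt_right hθ hx0 hx1
      linarith
    obtain ⟨s, hs, h7, h8, h9⟩ := h.exists_right_eventuallyEq hθ h3.1
      (hx1.trans_le (hin _ hlow.le le_rfl).1.2)
      (((continuous_profile (θ := θ) 1).continuousAt.eventually_lt
        (continuous_profile w).continuousAt h6).filter_mono nhdsWithin_le_nhds)
    rcases h7.1.eq_or_lt with h10 | h10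
    · have := hmax s (Finset.mem_filter.2 ⟨hs, h10 ▸ h9⟩)
      linarith
    · obtain rfl := h.eq_of_right_eq hθ hs ht h10 h7.2 hx0 hx1 (h8.trans hx.symm)
      exact h9

/-- A dissection contains a tile at some descent. -/
theorem exists_tileAt_mem (hθ : IsAdmissible θ) (h : Dissects θ w T) {k : ℕ} {hk : k + 1 < n}
    (hd : IsDescent w k hk) : ∃ j hj, ∃ hdj : IsDescent w j hj, tileAt θ w j hj hdj ∈ T := by
  obtain ⟨d, hd0, hd1⟩ := exists_between (depth_lt hθ w (show k < k + 2 by omega) hk)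
  have hdn : 0 ≤ d := (depth_nonneg hθ w (by omega)).trans hd0.le
  have hdl : d ≤ depth θ 1 n := hd1.le.trans (depth_le_last hθ w hk)
  have hlt : profile θ 1 d < profile θ w d := by
    refine (profile_one_le hθ (swapAt w k hk) hdn hdl).trans_lt ?_
    rw [← left_tileAt w hk hθ hd hd0.le hd1.le, ← right_tileAt w hk hθ hd hd0.le hd1.le]
    exact (tileAt θ w k hk hd).left_lt_right hθ hd0 (by rw [lower_tileAt]; exact hd1)
  obtain ⟨t, ht, hr⟩ := h.exists_right_eqOn hθ hdn hdl hlt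
  have ha := hθ.drop_pos t.a
  have hb := hθ.drop_pos t.b
  have hlow : t.lower θ = t.upper + drop θ t.b + drop θ t.a := by rw [Tile.lower]; ring
  have hin := h.inside t ht
  have hu0 : 0 ≤ t.upper := (hin _ le_rfl (by linarith)).1.1
  have hl0 : t.lower θ ≤ depth θ 1 n := (hin _ (by linarith) le_rfl).1.2
  -- On the shared stretch one-sided slopes agree, and slopes determine labels.
  have huniq : ∀ x α β, t.upper ≤ x → x < t.lower θ → RightAffine (t.right θ) x α →
      RightAffine (profile θ w) x β → α = β := by
    intro x α β hx0 hx1 hα hβ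
    refine (hα.eq_of_frequently hβ (Eventually.frequently ?_)).2
    filter_upwards [Ioo_mem_nhdsGT hx1] with y hy
    exact hr y ⟨hx0.trans hy.1.le, hy.2.le⟩
  have hinj := hθ.slope_strictMono.injective
  obtain ⟨j, hj, h3, h4⟩ := exists_window w hu0 (by linarith)
  have hwj : t.b = w ⟨j, hj⟩ := hinj <| huniq t.upper _ _ le_rfl (by linarith)
    (t.rightAffine_right_of_lt le_rfl (by linarith)) (rightAffine_profile hθ w hj h3 h4)
  have hsucc := depth_succ (θ := θ) w hj
  rw [← hwj] at hsucc
  have hj' : j + 1 < n := by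
    by_contra hc
    obtain rfl : n = j + 1 := by omega
    rw [← depth_last w] at hl0
    linarith
  have hsucc' := depth_succ (θ := θ) w hj'
  have hp := hθ.drop_pos (w ⟨j + 1, hj'⟩)
  -- If edge `j` began above the tile, it would end before the tile's right corner, so edge `j + 1`
  -- would also carry label `b`.
  have heq : depth θ w j = t.upper := by
    refine h3.eq_of_not_lt fun h5 => ?_
    have := hinj <| huniq (depth θ w (j + 1)) _ _ h4.le (by linarith)
      (t.rightAffine_right_of_lt h4.le (by linarith))
      (rightAffine_profile hθ w hj' le_rfl (by linarith))
    rw [hwj] at this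
    simpa [Fin.ext_iff] using w.injective this
  have hwj' : t.a = w ⟨j + 1, hj'⟩ := hinj <| huniq (depth θ w (j + 1)) _ _ (by linarith)
    (by linarith) (t.rightAffine_right_of_ge (by linarith))
    (rightAffine_profile hθ w hj' le_rfl (by linarith))
  have hdj : IsDescent w j hj' := by
    have := t.a_lt_b
    rwa [hwj, hwj'] at this
  have htop : t.top = pathVertex θ w j := by
    apply Complex.ext
    · rw [← profile_depth w hθ hj.le, heq, ← hr _ ⟨le_rfl, by linarith⟩, Tile.right]
      simp [hb.le]
    · simp only [depth, Tile.upper] at heq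
      linarith
  refine ⟨j, hj', hdj, ?_⟩
  have : t = tileAt θ w j hj' hdj := by
    cases t
    subst htop hwj hwj'
    rfl
  rwa [← this]

/-- The tile at a descent lies in every dissection if its labels occur in no decreasing triple of
values in which they are the first two or the last two. -/
theorem tileAt_mem (hθ : IsAdmissible θ) (h : Dissects θ w T) {k : ℕ} {hk : k + 1 < n}
    (hd : IsDescent w k hk) (hbefore : ∀ i : Fin n, i.val < k → w i < w ⟨k, by omega⟩)
    (hafter : ∀ i : Fin n, k + 1 < i.val → w ⟨k + 1, hk⟩ < w i) : tileAt θ w k hk hd ∈ T := by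
  classical
  induction hN : T.card using Nat.strong_induction_on generalizing w T with
  | _ N ih =>
    -- Peel off the tile at some descent `j ≠ k`. The hypotheses exclude `j = k ± 1`, so the
    -- exchange preserves both hypotheses and the tile at `k`, while the number of tiles drops.
    obtain ⟨j, hj, hdj, hmem⟩ := h.exists_tileAt_mem hθ hd
    by_cases hjk : j = k
    · subst hjk; exact hmem
    have h1 : j ≠ k + 1 := by
      rintro rfl
      exact absurd hdj (hafter ⟨k + 1 + 1, hj⟩ (by simp)).not_gt
    have h2 : j + 1 ≠ k := by
      rintro rfl
      exact absurd hdj (hbefore ⟨j, by omega⟩ (by simp)).not_gt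
    have e0 : swapAt w j hj ⟨k, by omega⟩ = w ⟨k, by omega⟩ :=
      swapAt_of_ne w hj (by simp; omega) (by simp; omega)
    have e1 : swapAt w j hj ⟨k + 1, hk⟩ = w ⟨k + 1, hk⟩ :=
      swapAt_of_ne w hj (by simp; omega) (by simp; omega)
    have ev : pathVertex θ (swapAt w j hj) k = pathVertex θ w k :=
      pathVertex_swapAt w hj (by omega)
    have hd' : IsDescent (swapAt w j hj) k hk := by
      rw [IsDescent, e0, e1]; exact hd
    have hsw : ∀ i : Fin n, ∃ i' : Fin n, swapAt w j hj i = w i' ∧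
        (i.val < k → i'.val < k) ∧ (k + 1 < i.val → k + 1 < i'.val) := by
      intro i
      by_cases hi : i.val = j
      · refine ⟨⟨j + 1, hj⟩, ?_, by simp; omega, by simp; omega⟩
        have : i = ⟨j, by omega⟩ := Fin.ext hi
        exact (congrArg _ this).trans (swapAt_left w hj)
      by_cases hi' : i.val = j + 1
      · refine ⟨⟨j, by omega⟩, ?_, by simp; omega, by simp; omega⟩
        have : i = ⟨j + 1, hj⟩ := Fin.ext hi'
        exact (congrArg _ this).trans (swapAt_right w hj)
      exact ⟨i, swapAt_of_ne w hj hi hi', id, id⟩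
    have := ih _ (hN ▸ Finset.card_erase_lt_of_mem hmem) (h.erase hθ hdj hmem) hd'
      (fun i hi => by
        obtain ⟨i', hi', h3, -⟩ := hsw i
        rw [hi', e0]; exact hbefore i' (h3 hi))
      (fun i hi => by
        obtain ⟨i', hi', -, h3⟩ := hsw i
        rw [hi', e1]; exact hafter i' (h3 hi)) rfl
    have he : tileAt θ (swapAt w j hj) k hk hd' = tileAt θ w k hk hd := by
      simp only [tileAt, e0, e1, ev]
    rw [he] at this
    exact Finset.mem_of_mem_erase this

end Dissects

/-! ### Right-perimeter tiles sit at descents -/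

theorem edgeVec_injective (hθ : IsAdmissible θ) : Function.Injective (edgeVec θ) := by
  intro i j h
  have h1 := congrArg Complex.re h
  have h2 := congrArg Complex.im h
  simp only [edgeVec_re, edgeVec_im, neg_inj] at h1 h2
  exact hθ.slope_strictMono.injective (by rw [slope, slope, h1, h2])

theorem endpoints_eq_of_segment_eq {x y x' y' : ℂ} (h : y.im < x.im) (h' : y'.im < x'.im)
    (he : segment ℝ x y = segment ℝ x' y') : x = x' ∧ y = y' := by
  have key : ∀ {x y z : ℂ}, y.im < x.im → z ∈ segment ℝ x y →
      (z.im ≤ x.im ∧ y.im ≤ z.im) ∧ (z.im = x.im → z = x) ∧ (z.im = y.im → z = y) := by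
    intro x y z hxy hz
    obtain ⟨a, b, ha, hb, hab, rfl⟩ := hz
    obtain rfl : a = 1 - b := by linarith
    simp only [Complex.add_im, Complex.smul_im, smul_eq_mul]
    refine ⟨⟨by nlinarith, by nlinarith⟩, fun h => ?_, fun h => ?_⟩
    · have : b * (y.im - x.im) = 0 := by linear_combination h
      obtain rfl : b = 0 := (mul_eq_zero.1 this).resolve_right (by linarith)
      simp
    · have : (1 - b) * (x.im - y.im) = 0 := by linear_combination h
      obtain rfl : b = 1 := by linarith [(mul_eq_zero.1 this).resolve_right (by linarith)]
      simp
  have hx := key h' (he ▸ left_mem_segment ℝ x y)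
  have hy := key h' (he ▸ right_mem_segment ℝ x y)
  have hx' := key h (he ▸ left_mem_segment ℝ x' y')
  have hy' := key h (he ▸ right_mem_segment ℝ x' y')
  exact ⟨hx.2.1 (le_antisymm hx.1.1 hx'.1.1), hy.2.2 (le_antisymm hy'.1.2 hy.1.2)⟩

theorem pathEdge_eq (w : Equiv.Perm (Fin n)) {k : ℕ} (hk : k < n) : pathEdge θ w k =
    segment ℝ (pathVertex θ w k) (pathVertex θ w k + edgeVec θ (w ⟨k, hk⟩)) := by
  rw [pathEdge, pathVertex_succ w hk]

theorem vertex_of_segment_eq (hθ : IsAdmissible θ) {p q : ℂ} {i j : Fin n}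
    (h : segment ℝ p (p + edgeVec θ i) = segment ℝ q (q + edgeVec θ j)) : p = q ∧ i = j := by
  obtain ⟨rfl, h2⟩ := endpoints_eq_of_segment_eq
    (by simpa using hθ.drop_pos i) (by simpa using hθ.drop_pos j) h
  exact ⟨rfl, edgeVec_injective hθ (add_left_cancel h2)⟩

theorem pathEdge_mem_edges (hθ : IsAdmissible θ) {w : Equiv.Perm (Fin n)} {k : ℕ} (hk : k < n)
    {t : Tile n} (h : pathEdge θ w k ∈ t.edges θ) :
    (pathVertex θ w k = t.top ∧ w ⟨k, hk⟩ = t.a) ∨ (pathVertex θ w k = t.top ∧ w ⟨k, hk⟩ = t.b) ∨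
    (pathVertex θ w k = t.top + edgeVec θ t.a ∧ w ⟨k, hk⟩ = t.b) ∨
    (pathVertex θ w k = t.top + edgeVec θ t.b ∧ w ⟨k, hk⟩ = t.a) := by
  rw [pathEdge_eq w hk] at h
  rcases h with h | h | h | h
  · exact Or.inl (vertex_of_segment_eq hθ h)
  · exact Or.inr (Or.inl (vertex_of_segment_eq hθ h))
  · exact Or.inr (Or.inr (Or.inl (vertex_of_segment_eq hθ h)))
  · rw [add_right_comm] at h
    exact Or.inr (Or.inr (Or.inr (vertex_of_segment_eq hθ h)))

theorem isRightPerimeter_tileAt (w : Equiv.Perm (Fin n)) {k : ℕ} (hk : k + 1 < n)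
    (hd : IsDescent w k hk) : IsRightPerimeter θ w (tileAt θ w k hk hd) := by
  have hk' : k < n := by omega
  refine ⟨k, hk, Or.inr (Or.inl (pathEdge_eq w hk')), Or.inr (Or.inr (Or.inr ?_))⟩
  rw [Set.mem_singleton_iff, pathEdge_eq w hk, pathVertex_succ w hk', add_right_comm]
  rfl

theorem Dissects.eq_tileAt (hθ : IsAdmissible θ) {w : Equiv.Perm (Fin n)} {T : Finset (Tile n)}
    (h : Dissects θ w T) {t : Tile n} (ht : t ∈ T) (hr : IsRightPerimeter θ w t) :
    ∃ k hk, ∃ hd : IsDescent w k hk, t = tileAt θ w k hk hd := by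
  obtain ⟨k, hk, h1, h2⟩ := hr
  have hk' : k < n := by omega
  have ha := hθ.drop_pos t.a
  have hb := hθ.drop_pos t.b
  have h2 := pathEdge_mem_edges hθ hk h2
  rw [pathVertex_succ w hk'] at h2
  have hne : w ⟨k, hk'⟩ ≠ w ⟨k + 1, hk⟩ := fun he => by simpa using w.injective he
  have him : ∀ {x y : ℂ}, x = y → x.im ≠ y.im → False := fun he hn => hn (congrArg _ he)
  -- Heights and distinctness of labels leave two of sixteen cases: the path follows the tile's left
  -- side (`a`, then `b`) or its right side (`b`, then `a`).
  rcases pathEdge_mem_edges hθ hk' h1 with ⟨e1, l1⟩ | ⟨e1, l1⟩ | ⟨e1, l1⟩ | ⟨e1, l1⟩ <;>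
    rw [e1, l1] at h2 <;>
    rcases h2 with ⟨e2, l2⟩ | ⟨e2, l2⟩ | ⟨e2, l2⟩ | ⟨e2, l2⟩ <;>
    first
    | exact absurd (l1.trans l2.symm) hne
    | (exfalso; refine him e2 fun h3 => ?_; simp at h3; linarith)
    | skip
  -- Along its left side the tile would protrude to the right of the boundary.
  · exfalso
    have hlow : t.lower θ = t.upper + drop θ t.a + drop θ t.b := rfl
    have hu : t.upper = depth θ w k := by rw [depth, e1]; rfl
    have hd1 := depth_succ (θ := θ) w hk'
    rw [l1, ← hu] at hd1
    have h3 := (h.inside t ht (depth θ w (k + 1)) (by linarith) (by linarith)).2.2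
    have h4 := t.left_lt_right hθ (d := depth θ w (k + 1)) (by linarith) (by linarith)
    rw [profile_depth w hθ hk', pathVertex_succ w hk', e1, l1, Complex.add_re, edgeVec_re,
      ← hθ.slope_mul_drop] at h3
    rw [Tile.left, hd1, max_eq_left (by linarith)] at h4
    rw [hd1] at h3
    linarith
  · have hd : IsDescent w k hk := by
      rw [IsDescent, l1, l2]; exact t.a_lt_b
    refine ⟨k, hk, hd, ?_⟩
    cases t
    subst e1 l1 l2
    rfl

/-- Both tiles would have edge `k + 1` of the path on their right side. -/
theorem Dissects.not_adjacent (hθ : IsAdmissible θ) {w : Equiv.Perm (Fin n)} {T : Finset (Tile n)}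
    (h : Dissects θ w T) {k : ℕ} {hk : k + 1 < n} {hk' : k + 1 + 1 < n} {hd : IsDescent w k hk}
    {hd' : IsDescent w (k + 1) hk'} (h1 : tileAt θ w k hk hd ∈ T) :
    tileAt θ w (k + 1) hk' hd' ∉ T := by
  intro h2
  have l1 := depth_lt hθ w (show k < k + 1 by omega) (by omega)
  obtain ⟨d, hd0, hd1⟩ := exists_between (depth_lt hθ w (show k + 1 < k + 2 by omega) hk'.le)
  have l2 := depth_lt hθ w (show k + 2 < k + 3 by omega) hk'
  have he := h.eq_of_right_eq hθ h1 h2 (d := d) (l1.trans hd0) (by rw [lower_tileAt]; exact hd1)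
    hd0 (by rw [lower_tileAt]; exact hd1.trans l2)
    (by rw [right_tileAt w hk hθ hd (l1.trans hd0).le hd1.le,
      right_tileAt w hk' hθ hd' hd0.le (hd1.trans l2).le])
  exact l1.ne (congrArg Tile.upper he)

/-! ### Constraints on descents near a forced tile -/

namespace IsForcedRightPerimeter

variable {w : Equiv.Perm (Fin n)}

theorem mem (hθ : IsAdmissible θ) (hn : 1 < n) (hw : FullySupported w) {t : Tile n}
    (ht : IsForcedRightPerimeter θ w t) {T : Finset (Tile n)} (h : Dissects θ w T) : t ∈ T :=
  (ht T (h.isTiling hθ hn hw)).1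

theorem eq_tileAt (hθ : IsAdmissible θ) (hn : 1 < n) (hw : FullySupported w) {t : Tile n}
    (ht : IsForcedRightPerimeter θ w t) :
    ∃ k hk, ∃ hd : IsDescent w k hk, t = tileAt θ w k hk hd := by
  obtain ⟨T, h⟩ := exists_dissects hθ w
  obtain ⟨h1, h2⟩ := ht T (h.isTiling hθ hn hw)
  exact h.eq_tileAt hθ h1 h2

theorem not_isDescent_succ (hθ : IsAdmissible θ) (hn : 1 < n) (hw : FullySupported w) {k : ℕ}
    {hk : k + 1 < n} {hd : IsDescent w k hk} (ht : IsForcedRightPerimeter θ w (tileAt θ w k hk hd))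
    (hk' : k + 1 + 1 < n) : ¬ IsDescent w (k + 1) hk' := by
  classical
  intro hd'
  obtain ⟨T, h⟩ := exists_dissects hθ (swapAt w (k + 1) hk')
  have h1 := h.insert hθ hd'
  exact h1.not_adjacent hθ (ht.mem hθ hn hw h1) (Finset.mem_insert_self _ _)

/-- Otherwise exchanging at `k` creates a descent at `k + 1`. A dissection containing the tile there
has edge `k + 2` of `w` on the right of that tile, leaving no room for the forced one. -/
theorem lt_of_isDescent_before (hθ : IsAdmissible θ) (hn : 1 < n) (hw : FullySupported w) {k : ℕ}
    {hk : k + 2 + 1 < n} {hd : IsDescent w (k + 2) hk}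
    (ht : IsForcedRightPerimeter θ w (tileAt θ w (k + 2) hk hd))
    (hd' : IsDescent w k (by omega)) : w ⟨k, by omega⟩ < w ⟨k + 2, by omega⟩ := by
  classical
  by_contra hc
  have hlt : w ⟨k + 2, by omega⟩ < w ⟨k, by omega⟩ :=
    lt_of_le_of_ne (not_lt.1 hc) fun he => by simpa using w.injective he
  have hk0 : k + 1 < n := by omega
  have hk1 : k + 1 + 1 < n := by omega
  have hd₁ : IsDescent (swapAt w k hk0) (k + 1) hk1 := by
    rw [IsDescent, swapAt_right, swapAt_of_ne w hk0 (by simp; omega) (by simp)]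
    exact hlt
  obtain ⟨T, h⟩ := exists_dissects hθ (swapAt (swapAt w k hk0) (k + 1) hk1)
  have h1 := (h.insert hθ hd₁).insert hθ hd'
  have m2 : depth θ (swapAt w k hk0) (k + 2) = depth θ w (k + 2) := depth_swapAt w hk0 (by omega)
  have m3 : depth θ (swapAt w k hk0) (k + 1 + 2) = depth θ w (k + 1 + 2) :=
    depth_swapAt w hk0 (by omega)
  have l1 := depth_lt hθ (swapAt w k hk0) (show k + 1 < k + 2 by omega) hk1.le
  have l2 := depth_lt hθ w (show k + 1 + 2 < k + 2 + 2 by omega) hk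
  obtain ⟨d, hd0, hd1⟩ := exists_between (depth_lt hθ w (show k + 2 < k + 1 + 2 by omega) hk.le)
  rw [m2] at l1
  have he := h1.eq_of_right_eq hθ (ht.mem hθ hn hw h1)
    (Finset.mem_insert_of_mem (Finset.mem_insert_self _ _)) (d := d) hd0
    (by rw [lower_tileAt]; exact hd1.trans l2) (l1.trans hd0)
    (by rw [lower_tileAt, m3]; exact hd1)
    (by rw [right_tileAt w hk hθ hd hd0.le (hd1.trans l2).le,
      right_tileAt _ hk1 hθ hd₁ (l1.trans hd0).le (m3 ▸ hd1.le),
      profile_swapAt w hk0 hθ ((depth_nonneg hθ w (by omega)).trans hd0.le)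
        (hd1.le.trans (depth_le_last hθ w (by omega))) (Or.inr hd0.le)])
  have hb := congrArg Tile.b he
  simp only [tileAt, swapAt_right] at hb
  simpa using w.injective hb

/-- Mirror image of `lt_of_isDescent_before`: exchange at `k + 2`, and the competing tile takes edge
`k + 1`. -/
theorem lt_of_isDescent_after (hθ : IsAdmissible θ) (hn : 1 < n) (hw : FullySupported w) {k : ℕ}
    {hk : k + 1 < n} {hd : IsDescent w k hk}
    (ht : IsForcedRightPerimeter θ w (tileAt θ w k hk hd)) {hk2 : k + 2 + 1 < n}
    (hd' : IsDescent w (k + 2) hk2) : w ⟨k + 1, hk⟩ < w ⟨k + 3, hk2⟩ := by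
  classical
  by_contra hc
  have hlt : w ⟨k + 3, hk2⟩ < w ⟨k + 1, hk⟩ :=
    lt_of_le_of_ne (not_lt.1 hc) fun he => by simpa using w.injective he
  have hk1 : k + 1 + 1 < n := by omega
  have hd₁ : IsDescent (swapAt w (k + 2) hk2) (k + 1) hk1 := by
    have e : swapAt w (k + 2) hk2 ⟨k + 1 + 1, hk1⟩ = w ⟨k + 3, hk2⟩ := swapAt_left w hk2
    rw [IsDescent, e, swapAt_of_ne w hk2 (by simp) (by simp)]
    exact hlt
  obtain ⟨T, h⟩ := exists_dissects hθ (swapAt (swapAt w (k + 2) hk2) (k + 1) hk1)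
  have h1 := (h.insert hθ hd₁).insert hθ hd'
  have m1 : depth θ (swapAt w (k + 2) hk2) (k + 1) = depth θ w (k + 1) :=
    depth_swapAt w hk2 (by omega)
  have m2 : depth θ (swapAt w (k + 2) hk2) (k + 2) = depth θ w (k + 2) :=
    depth_swapAt w hk2 (by omega)
  have l1 := depth_lt hθ w (show k < k + 1 by omega) hk.le
  have l2 := depth_lt hθ (swapAt w (k + 2) hk2) (show k + 2 < k + 1 + 2 by omega) hk2.le
  obtain ⟨d, hd0, hd1⟩ := exists_between (depth_lt hθ w (show k + 1 < k + 2 by omega) hk1.le)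
  rw [m2] at l2
  have he := h1.eq_of_right_eq hθ (ht.mem hθ hn hw h1)
    (Finset.mem_insert_of_mem (Finset.mem_insert_self _ _)) (d := d) (l1.trans hd0)
    (by rw [lower_tileAt]; exact hd1) (by rw [upper_tileAt, m1]; exact hd0)
    (by rw [lower_tileAt]; exact hd1.trans l2)
    (by rw [right_tileAt w hk hθ hd (l1.trans hd0).le hd1.le,
      right_tileAt _ hk1 hθ hd₁ (m1 ▸ hd0.le) (hd1.trans l2).le,
      profile_swapAt w hk2 hθ ((depth_nonneg hθ w (by omega)).trans hd0.le)
        (hd1.le.trans (depth_le_last hθ w (by omega))) (Or.inl hd1.le)])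
  have hb := congrArg Tile.b he
  simp only [tileAt] at hb
  rw [swapAt_of_ne w hk2 (by simp) (by simp)] at hb
  simpa using w.injective hb

end IsForcedRightPerimeter

theorem isForcedRightPerimeter_tileAt (hθ : IsAdmissible θ) {w : Equiv.Perm (Fin n)} {k : ℕ}
    {hk : k + 1 < n} (hd : IsDescent w k hk)
    (hbefore : ∀ i : Fin n, i.val < k → w i < w ⟨k, by omega⟩)
    (hafter : ∀ i : Fin n, k + 1 < i.val → w ⟨k + 1, hk⟩ < w i) :
    IsForcedRightPerimeter θ w (tileAt θ w k hk hd) := fun _ hT =>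
  ⟨(hT.dissects hθ (by omega)).tileAt_mem hθ hd hbefore hafter, isRightPerimeter_tileAt w hk hd⟩

end

/-! ### Counting forced tiles by pairs of positions -/

/-- The position of the upper right edge of a right-perimeter tile. -/
def position {n : ℕ} (w : Equiv.Perm (Fin n)) (t : Tile n) : ℕ := (w.symm t.b).val

theorem position_tileAt {n : ℕ} {θ : Fin n → ℝ} (w : Equiv.Perm (Fin n)) {k : ℕ} (hk : k + 1 < n)
    (hd : IsDescent w k hk) : position w (tileAt θ w k hk hd) = k := by
  simp [position, tileAt]

variable {m : ℕ} {θ : Fin (2 * m) → ℝ} {w : Equiv.Perm (Fin (2 * m))}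

theorem mapsTo_position (hθ : IsAdmissible θ) (hm : 0 < m) (hw : FullySupported w) :
    Set.MapsTo (fun t => position w t / 2) {t | IsForcedRightPerimeter θ w t}
      (Finset.range m : Set ℕ) := by
  intro t ht
  obtain ⟨k, hk, hd, rfl⟩ := IsForcedRightPerimeter.eq_tileAt hθ (by omega) hw ht
  simp only [position_tileAt, Finset.coe_range, Set.mem_Iio]
  omega

/-- Distinct forced tiles with the same half-position would be at consecutive descents. -/
theorem injOn_position (hθ : IsAdmissible θ) (hm : 0 < m) (hw : FullySupported w) :
    Set.InjOn (fun t => position w t / 2) {t | IsForcedRightPerimeter θ w t} := by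
  intro s hs t ht hst
  obtain ⟨j, hj, hdj, rfl⟩ := IsForcedRightPerimeter.eq_tileAt hθ (by omega) hw hs
  obtain ⟨k, hk, hdk, rfl⟩ := IsForcedRightPerimeter.eq_tileAt hθ (by omega) hw ht
  simp only [position_tileAt] at hst
  obtain rfl | rfl | rfl : j = k ∨ k = j + 1 ∨ j = k + 1 := by omega
  · rfl
  · exact absurd hdk (IsForcedRightPerimeter.not_isDescent_succ hθ (by omega) hw hs hk)
  · exact absurd hdj (IsForcedRightPerimeter.not_isDescent_succ hθ (by omega) hw ht hj)

theorem numForcedRight_le (hθ : IsAdmissible θ) (hm : 0 < m) (hw : FullySupported w) :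
    numForcedRight θ w ≤ m := by
  have := Set.encard_le_encard_of_injOn (mapsTo_position hθ hm hw) (injOn_position hθ hm hw)
  rwa [Set.encard_coe_eq_coe_finsetCard, Finset.card_range] at this

theorem isForcedRightPerimeter_of_numForcedRight_eq (hθ : IsAdmissible θ) (hm : 0 < m)
    (hw : FullySupported w) (h : numForcedRight θ w = m) (i : ℕ) (hi : i < m) :
    ∃ hd : IsDescent w (2 * i) (by omega),
      IsForcedRightPerimeter θ w (tileAt θ w (2 * i) (by omega) hd) := by
  have himg : (fun t => position w t / 2) '' {t | IsForcedRightPerimeter θ w t} =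
      (Finset.range m : Set ℕ) := by
    have hsub := (mapsTo_position hθ hm hw).image_subset
    refine ((Finset.finite_toSet _).subset hsub).eq_of_subset_of_encard_le hsub ?_
    rw [(injOn_position hθ hm hw).encard_image, Set.encard_coe_eq_coe_finsetCard,
      Finset.card_range]
    exact h.ge
  have hex : ∀ i < m, ∃ k hk, ∃ hd : IsDescent w k hk,
      IsForcedRightPerimeter θ w (tileAt θ w k hk hd) ∧ k / 2 = i := by
    intro i hi
    obtain ⟨t, ht, hti⟩ : i ∈ (fun t => position w t / 2) ''
        {t | IsForcedRightPerimeter θ w t} := by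
      rw [himg]; simpa using hi
    obtain ⟨k, hk, hd, rfl⟩ := IsForcedRightPerimeter.eq_tileAt hθ (by omega) hw ht
    exact ⟨k, hk, hd, ht, by simpa [position_tileAt] using hti⟩
  -- Work from the last pair back: position `2i + 1` is impossible, as `2(i + 1)` is already known
  -- to be a descent. In the last pair, position `2m - 1` has no successor.
  induction hj : m - i generalizing i with
  | zero => omega
  | succ j ih =>
    obtain ⟨k, hk, hd, hf, hki⟩ := hex i hi
    obtain rfl | rfl : k = 2 * i ∨ k = 2 * i + 1 := by omega
    · exact ⟨hd, hf⟩
    · exfalso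
      obtain ⟨hd', -⟩ := ih (i + 1) (by omega) (by omega)
      exact hf.not_isDescent_succ hθ (by omega) hw (by omega) hd'

theorem strictMono_of_lt_succ {α : Type*} [Preorder α] (f : Fin m → α)
    (h : ∀ i (hi : i + 1 < m), f ⟨i, by omega⟩ < f ⟨i + 1, hi⟩) : StrictMono f := by
  cases m with
  | zero => exact fun i => i.elim0
  | succ m =>
    rw [Fin.strictMono_iff_lt_succ]
    exact fun i => h i.val (by omega)

theorem two_mul_val_lt (k : Fin m) : 2 * k.val < 2 * m := by omega

theorem two_mul_val_succ_lt (k : Fin m) : 2 * k.val + 1 < 2 * m := by omega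

theorem numForcedRight_eq_of_strictMono (hθ : IsAdmissible θ) (hm : 0 < m) (hw : FullySupported w)
    (h0 : ∀ k : Fin m, w ⟨2 * k.val, two_mul_val_lt k⟩ > w ⟨2 * k.val + 1, two_mul_val_succ_lt k⟩)
    (h1 : StrictMono (fun k : Fin m => w ⟨2 * k.val, two_mul_val_lt k⟩))
    (h2 : StrictMono (fun k : Fin m => w ⟨2 * k.val + 1, two_mul_val_succ_lt k⟩)) :
    numForcedRight θ w = m := by
  refine le_antisymm (numForcedRight_le hθ hm hw) ?_
  have hparity : ∀ i : Fin (2 * m), ∃ j : Fin m,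
      i = ⟨2 * j.val, two_mul_val_lt j⟩ ∨ i = ⟨2 * j.val + 1, two_mul_val_succ_lt j⟩ := by
    intro i
    refine ⟨⟨i.val / 2, by omega⟩, ?_⟩
    simp only [Fin.ext_iff]
    omega
  have hsub : (Finset.range m : Set ℕ) ⊆
      (fun t => position w t / 2) '' {t | IsForcedRightPerimeter θ w t} := by
    intro k hk
    have hk : k < m := by simpa using hk
    have hd : IsDescent w (2 * k) (by omega) := h0 ⟨k, hk⟩
    -- Earlier values are bounded by the even chain, later ones by the odd chain; a value of the
    -- other parity is first compared with its partner.
    refine ⟨tileAt θ w (2 * k) (by omega) hd, isForcedRightPerimeter_tileAt hθ hd ?_ ?_, ?_⟩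
    · intro i hi
      obtain ⟨j, rfl | rfl⟩ := hparity i
      · exact h1 (show j < ⟨k, hk⟩ from Fin.lt_def.2 (by simp at hi ⊢; omega))
      · exact (h0 j).trans (h1 (show j < ⟨k, hk⟩ from Fin.lt_def.2 (by simp at hi ⊢; omega)))
    · intro i hi
      obtain ⟨j, rfl | rfl⟩ := hparity i
      · exact (h2 (show ⟨k, hk⟩ < j from Fin.lt_def.2 (by simp at hi ⊢; omega))).trans (h0 j)
      · exact h2 (show ⟨k, hk⟩ < j from Fin.lt_def.2 (by simp at hi ⊢; omega))
    · simp [position_tileAt]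
  have := (Set.encard_le_encard hsub).trans (Set.encard_image_le _ _)
  rwa [Set.encard_coe_eq_coe_finsetCard, Finset.card_range] at this

theorem strictMono_of_numForcedRight_eq (hθ : IsAdmissible θ) (hm : 0 < m) (hw : FullySupported w)
    (h : numForcedRight θ w = m) :
    (∀ k : Fin m, w ⟨2 * k.val, two_mul_val_lt k⟩ > w ⟨2 * k.val + 1, two_mul_val_succ_lt k⟩) ∧
      StrictMono (fun k : Fin m => w ⟨2 * k.val, two_mul_val_lt k⟩) ∧
      StrictMono (fun k : Fin m => w ⟨2 * k.val + 1, two_mul_val_succ_lt k⟩) := by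
  have hf := isForcedRightPerimeter_of_numForcedRight_eq hθ hm hw h
  refine ⟨fun k => (hf k k.2).1, strictMono_of_lt_succ _ fun i hi => ?_,
    strictMono_of_lt_succ _ fun i hi => ?_⟩
  · obtain ⟨hd, -⟩ := hf i (by omega)
    obtain ⟨hd', ht⟩ := hf (i + 1) hi
    exact ht.lt_of_isDescent_before (k := 2 * i) hθ (by omega) hw hd
  · obtain ⟨hd, ht⟩ := hf i (by omega)
    obtain ⟨hd', -⟩ := hf (i + 1) hi
    exact ht.lt_of_isDescent_after hθ (by omega) hw hd'

/-! ### A permutation attaining the maximum -/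

/-- The permutation with one-line notation `m, 0, m + 1, 1, …, 2m - 1, m - 1`. -/
def interleave (m : ℕ) : Equiv.Perm (Fin (2 * m)) :=
  Equiv.ofBijective
    (fun i => ⟨if i.val % 2 = 0 then m + i.val / 2 else i.val / 2, by split_ifs <;> omega⟩)
    (Finite.injective_iff_bijective.1 fun i j h => by
      have h := congrArg Fin.val h
      ext
      dsimp only at h
      split_ifs at h <;> omega)

theorem interleave_even (k : ℕ) (hk : 2 * k < 2 * m) :
    (interleave m ⟨2 * k, hk⟩).val = m + k := by
  simp [interleave]

theorem interleave_odd (k : ℕ) (hk : 2 * k + 1 < 2 * m) :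
    (interleave m ⟨2 * k + 1, hk⟩).val = k := by
  have h1 : (2 * k + 1) % 2 = 1 := by omega
  have h2 : (2 * k + 1) / 2 = k := by omega
  simp [interleave, h1, h2]

theorem fullySupported_interleave : FullySupported (interleave m) := by
  intro r h0 hr h
  have key : ∀ k, 2 * k < r → m + k < r := by
    intro k hk
    have : interleave m ⟨2 * k, by omega⟩ ∈ interleave m '' {i | i.val < r} :=
      Set.mem_image_of_mem _ hk
    rw [h] at this
    simpa [interleave_even] using this
  -- The value `m` at position `0` forces `m < r`. Then `r < 2m` puts position `2(r - m)` below `r`,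
  -- but its value is `r`.
  have h1 := key 0 h0
  have h2 := key (r - m) (by omega)
  omega

theorem numForcedRight_interleave (hθ : IsAdmissible θ) (hm : 0 < m) :
    numForcedRight θ (interleave m) = m := by
  refine numForcedRight_eq_of_strictMono hθ hm fullySupported_interleave
    (fun k => ?_) (fun i j hij => ?_) (fun i j hij => ?_)
  · rw [gt_iff_lt, Fin.lt_def, interleave_even, interleave_odd]; omega
  · rw [Fin.lt_def, interleave_even, interleave_even]; omega
  · rw [Fin.lt_def, interleave_odd, interleave_odd]; omega

theorem numForcedRight_fin_zero {n : ℕ} (hn : n = 0) (θ : Fin n → ℝ) (w : Equiv.Perm (Fin n)) :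
    numForcedRight θ w = 0 := by
  subst hn
  rw [numForcedRight, Set.encard_eq_zero]
  exact Set.eq_empty_of_forall_notMem fun t => t.a.elim0

end Elnitsky

end

theorem theorem5 (m : ℕ) (θ : Fin (2 * m) → ℝ) (hθ : Elnitsky.IsAdmissible θ) :
    IsGreatest
        {c : ℕ∞ | ∃ w : Equiv.Perm (Fin (2 * m)),
          Elnitsky.FullySupported w ∧ c = Elnitsky.numForcedRight θ w}
        (m : ℕ∞) ∧
      ∀ w : Equiv.Perm (Fin (2 * m)), Elnitsky.FullySupported w →
        (Elnitsky.numForcedRight θ w = (m : ℕ∞) ↔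
          (∀ k : Fin m, w ⟨2 * k.val, by omega⟩ > w ⟨2 * k.val + 1, by omega⟩) ∧
            StrictMono (fun k : Fin m => w ⟨2 * k.val, by omega⟩) ∧
            StrictMono (fun k : Fin m => w ⟨2 * k.val + 1, by omega⟩)) := by
  rcases Nat.eq_zero_or_pos m with rfl | hm
  -- For `m = 0` there are no labels, hence no tiles, and all conditions are vacuous.
  · have h0 := Elnitsky.numForcedRight_fin_zero (mul_zero 2) θ
    refine ⟨⟨⟨1, fun r h1 h2 => absurd h2 (by omega), by rw [h0]; rfl⟩, ?_⟩, fun w _ => ?_⟩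
    · rintro _ ⟨w, -, rfl⟩
      exact (h0 w).le
    · exact iff_of_true (by rw [h0]; rfl)
        ⟨fun k => k.elim0, fun k => k.elim0, fun k => k.elim0⟩
  · refine ⟨⟨⟨Elnitsky.interleave m, Elnitsky.fullySupported_interleave,
      (Elnitsky.numForcedRight_interleave hθ hm).symm⟩, ?_⟩, fun w hw =>
      ⟨Elnitsky.strictMono_of_numForcedRight_eq hθ hm hw, fun h =>
        Elnitsky.numForcedRight_eq_of_strictMono hθ hm hw h.1 h.2.1 h.2.2⟩⟩
    rintro _ ⟨w, hw, rfl⟩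
    exact Elnitsky.numForcedRight_le hθ hm hw
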